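/- Let $\mathcal{H}_3=\mathbb{C}\times\mathbb{R}$ be the three-dimensional Heisenberg group, with points $(z,t)$, $z=y_1+iy_2$, and Haar measure equal to Lebesgue measure $dz\,dt$. Let $X=\partial_{y_1}-2y_2\,\partial_t$ and $Y=\partial_{y_2}+2y_1\,\partial_t$, and let $\mathcal{L}=-(X^2+Y^2)$ be the sub-Laplacian, regarded as an unbounded operator on $L^2(\mathcal{H}_3)$ with the Schwartz space $\mathcal{S}(\mathcal{H}_3)$ as its domain. Then $\mathcal{L}$ is densely defined and closable, and its closure $\mathcal{L}_0$ satisfies $$\Sigma(\mathcal{L}_0)=\Sigma_c(\mathcal{L}_0)=[0,\infty).$$ Here, for a closed, densely defined operator $\mathcal{T}$ with domain $\mathcal{D}(\mathcal{T})$ on a complex Banach space $E$, the spectrum $\Sigma(\mathcal{T})$ is the set of all $\lambda\in\mathbb{C}$ for which $\mathcal{T}-\lambda I:\mathcal{D}(\mathcal{T})\to E$ is not bijective, and the continuous spectrum $\Sigma_c(\mathcal{T})$ is the set of all $\lambda\in\mathbb{C}$ for which $\mathcal{T}-\lambda I$ is injective and has dense range, and its inverse, defined on that range, is unbounded. -/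

import Mathlib

open MeasureTheory LineDeriv
open scoped SchwartzMap

noncomputable section

namespace Heisenberg

/-! ### The sub-Laplacian on Schwartz functions -/

/-- The manifold underlying the three-dimensional Heisenberg group: points are `(z, t)` with
`z = x + i y`.  The Haar measure is the Lebesgue measure `volume` on `ℂ × ℝ`. -/
abbrev H3 : Type := ℂ × ℝ

instance : (volume : Measure H3).IsAddHaarMeasure :=
  inferInstanceAs (((volume : Measure ℂ).prod (volume : Measure ℝ)).IsAddHaarMeasure)

/-- The vector field `X = ∂/∂x - 2 y ∂/∂t`, acting on Schwartz functions. -/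
def X : 𝓢(H3, ℂ) →L[ℂ] 𝓢(H3, ℂ) :=
  lineDerivOpCLM ℂ 𝓢(H3, ℂ) ((1, 0) : H3) -
    (SchwartzMap.smulLeftCLM ℂ (fun p : H3 => ((2 * p.1.im : ℝ) : ℂ))) ∘L
      lineDerivOpCLM ℂ 𝓢(H3, ℂ) ((0, 1) : H3)

/-- The vector field `Y = ∂/∂y + 2 x ∂/∂t`, acting on Schwartz functions. -/
def Y : 𝓢(H3, ℂ) →L[ℂ] 𝓢(H3, ℂ) :=
  lineDerivOpCLM ℂ 𝓢(H3, ℂ) ((Complex.I, 0) : H3) +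
    (SchwartzMap.smulLeftCLM ℂ (fun p : H3 => ((2 * p.1.re : ℝ) : ℂ))) ∘L
      lineDerivOpCLM ℂ 𝓢(H3, ℂ) ((0, 1) : H3)

/-- Multiplication by the coefficient of `X` is the genuine pointwise multiplication. -/
theorem X_apply (u : 𝓢(H3, ℂ)) (p : H3) :
    X u p = fderiv ℝ u p ((1, 0) : H3) - ((2 * p.1.im : ℝ) : ℂ) * fderiv ℝ u p ((0, 1) : H3) := by
  have h : (fun p : H3 => ((2 * p.1.im : ℝ) : ℂ)).HasTemperateGrowth :=
    (Complex.ofRealCLM ∘L ((2 : ℝ) • (Complex.imCLM ∘L ContinuousLinearMap.fst ℝ ℂ ℝ))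
      ).hasTemperateGrowth
  simp only [X, sub_apply, ContinuousLinearMap.comp_apply,
    SchwartzMap.smulLeftCLM_apply_apply h, smul_eq_mul,
    lineDerivOpCLM_apply, SchwartzMap.lineDerivOp_apply_eq_fderiv]

/-- Multiplication by the coefficient of `Y` is the genuine pointwise multiplication. -/
theorem Y_apply (u : 𝓢(H3, ℂ)) (p : H3) :
    Y u p = fderiv ℝ u p ((Complex.I, 0) : H3) +
      ((2 * p.1.re : ℝ) : ℂ) * fderiv ℝ u p ((0, 1) : H3) := by
  have h : (fun p : H3 => ((2 * p.1.re : ℝ) : ℂ)).HasTemperateGrowth :=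
    (Complex.ofRealCLM ∘L ((2 : ℝ) • (Complex.reCLM ∘L ContinuousLinearMap.fst ℝ ℂ ℝ))
      ).hasTemperateGrowth
  simp only [Y, add_apply, ContinuousLinearMap.comp_apply,
    SchwartzMap.smulLeftCLM_apply_apply h, smul_eq_mul,
    lineDerivOpCLM_apply, SchwartzMap.lineDerivOp_apply_eq_fderiv]

/-- The sub-Laplacian `-(X² + Y²)` on Schwartz functions. -/
def subLaplacianSchwartz : 𝓢(H3, ℂ) →L[ℂ] 𝓢(H3, ℂ) :=
  -(X ∘L X + Y ∘L Y)

/-! ### The sub-Laplacian as an unbounded operator on `L²` -/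

/-- The Hilbert space `L²(ℂ × ℝ)` with respect to Lebesgue measure. -/
abbrev L2 : Type := Lp ℂ 2 (volume : Measure H3)

/-- The inclusion of the Schwartz space into `L²`. -/
def schwartzToL2 : 𝓢(H3, ℂ) →ₗ[ℂ] L2 :=
  (SchwartzMap.toLpCLM ℂ ℂ 2 (volume : Measure H3)).toLinearMap

theorem schwartzToL2_injective : Function.Injective schwartzToL2 :=
  SchwartzMap.injective_toLp (E := H3) (F := ℂ) 2 volume

/-- The sub-Laplacian as an unbounded operator on `L²` whose domain is the space of (classes of)
Schwartz functions. -/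
def subLaplacian : L2 →ₗ.[ℂ] L2 where
  domain := LinearMap.range schwartzToL2
  toFun := schwartzToL2 ∘ₗ subLaplacianSchwartz.toLinearMap ∘ₗ
    (LinearEquiv.ofInjective schwartzToL2 schwartzToL2_injective).symm.toLinearMap

theorem subLaplacian_apply (u : 𝓢(H3, ℂ)) :
    subLaplacian ⟨schwartzToL2 u, LinearMap.mem_range_self schwartzToL2 u⟩ =
      schwartzToL2 (subLaplacianSchwartz u) := by
  have h : (LinearEquiv.ofInjective schwartzToL2 schwartzToL2_injective).symm
      ⟨schwartzToL2 u, LinearMap.mem_range_self schwartzToL2 u⟩ = u :=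
    (LinearEquiv.symm_apply_eq _).2 rfl
  exact congrArg (fun v => schwartzToL2 (subLaplacianSchwartz v)) h

/-! ### Spectra of unbounded operators -/

variable {E : Type*} [NormedAddCommGroup E] [NormedSpace ℂ E]

/-- The operator `T - λ I`, defined on the domain of `T`. -/
def shift (T : E →ₗ.[ℂ] E) (lam : ℂ) : T.domain →ₗ[ℂ] E :=
  T.toFun - lam • T.domain.subtype

/-- The resolvent set: all `λ` such that `T - λ I : D(T) → E` is bijective. -/
def resolventSet (T : E →ₗ.[ℂ] E) : Set ℂ :=
  {lam | Function.Bijective (shift T lam)}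

/-- The spectrum: the complement of the resolvent set in `ℂ`. -/
def spectrum (T : E →ₗ.[ℂ] E) : Set ℂ :=
  (resolventSet T)ᶜ

/-- The continuous spectrum: all `λ` such that `T - λ I` is injective, its range is dense, and its
inverse, as a map from the range to `D(T)`, is unbounded, i.e. there is no `C` with
`‖x‖ ≤ C ‖(T - λ I) x‖` for all `x ∈ D(T)`. -/
def continuousSpectrum (T : E →ₗ.[ℂ] E) : Set ℂ :=
  {lam | Function.Injective (shift T lam) ∧ DenseRange (shift T lam) ∧
    ¬ ∃ C : ℝ, ∀ x : T.domain, ‖(x : E)‖ ≤ C * ‖shift T lam x‖}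

end Heisenberg

end

/-! The abstract half is `spectrum_closure_eq`. If T is symmetric, an eigenvector of its closure at
λ is orthogonal to the range of T - conj λ, so dense range of all shifts excludes eigenvalues.
Positivity bounds T - λ below off [0,∞), and with closedness and dense range this makes the shifted
closure bijective. On [0,∞) approximate eigenvectors make the inverse unbounded. For the
sub-Laplacian, symmetry and positivity are integration by parts; dense range for every complex λ and
approximate eigenvectors remain.

Both come from the Fourier transform in all three variables. With dual variables (ζ, τ), the fields
X and Y become first-order operators in ζ with τ as a parameter, so for each τ ≠ 0 the sub-Laplacian
is a Landau Hamiltonian. On ψ(τ) ζ^a (conj ζ)^b exp(-π|ζ|²/(2|τ|)) it is triangular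
(`freqSubLaplacian_gaussSchwartz`): it multiplies by the level 8π(2n+1)|τ|, where n = a for τ > 0
and n = b for τ < 0, and adds a term in which a and b both drop by one.

Every level sweeps out the half line as τ varies, but meets a given λ only on a null set of τ; this
is why the spectrum is purely continuous. If ψ avoids the countably many τ at which some level
equals λ, back substitution solves the equation (`exists_freqSubLaplacian_sub_eq`), and the
monomials with such ψ are still total in L² (`dense_span_gaussSchwartz`), whence dense range. A bump
concentrated where the lowest level 8πτ is close to r gives approximate eigenvectors
(`exists_approx_eigenfunction`). -/

noncomputable section

namespace Heisenberg

/-! ### Spectra of closures of positive symmetric operators. -/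

section SymmetricOperators

variable {E : Type*} [NormedAddCommGroup E] [InnerProductSpace ℂ E]

theorem shift_apply (T : E →ₗ.[ℂ] E) (lam : ℂ) (x : T.domain) :
    shift T lam x = T x - lam • (x : E) := rfl

/-- A symmetric densely defined operator is closable. -/
theorem isClosable_of_symmetric {T : E →ₗ.[ℂ] E} [CompleteSpace E]
    (hd : Dense (T.domain : Set E))
    (hs : ∀ x y : T.domain, inner ℂ (T x) (y : E) = inner ℂ (x : E) (T y)) : T.IsClosable := by
  have h : T.IsFormalAdjoint T := fun x y => hs x y
  exact (LinearPMap.adjoint_isClosed hd).isClosable.leIsClosable (h.le_adjoint hd)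

/-- A closed condition on the graph passes from an operator to its closure. -/
theorem closure_induction {T : E →ₗ.[ℂ] E} (hT : T.IsClosable) {P : Set (E × E)}
    (hP : IsClosed P) (h : ∀ x : T.domain, ((x : E), T x) ∈ P) (x : T.closure.domain) :
    ((x : E), T.closure x) ∈ P := by
  have h1 : ((x : E), T.closure x) ∈ T.graph.topologicalClosure := by
    rw [hT.graph_closure_eq_closure_graph]
    exact T.closure.mem_graph x
  have h2 : (T.graph : Set (E × E)) ⊆ P := by
    rintro ⟨a, b⟩ hab
    obtain ⟨y, rfl, rfl⟩ := (LinearPMap.mem_graph_iff T).1 hab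
    exact h y
  exact closure_minimal h2 hP h1

theorem exists_closure_extension (T : E →ₗ.[ℂ] E) (x : T.domain) :
    ∃ x' : T.closure.domain, (x' : E) = x ∧ T.closure x' = T x :=
  ⟨⟨x, T.le_closure.1 x.2⟩, rfl, (T.le_closure.2 rfl).symm⟩

theorem range_shift_subset_closure (T : E →ₗ.[ℂ] E) (lam : ℂ) :
    Set.range (shift T lam) ⊆ Set.range (shift T.closure lam) := by
  rintro _ ⟨x, rfl⟩
  obtain ⟨x', h1, h2⟩ := exists_closure_extension T x
  exact ⟨x', by rw [shift_apply, shift_apply, h1, h2]⟩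

/-- If every `T - λ` has dense range and `T` is symmetric, then the closure of `T` has no
eigenvalues. -/
theorem injective_shift_closure {T : E →ₗ.[ℂ] E} (hT : T.IsClosable)
    (hs : ∀ x y : T.domain, inner ℂ (T x) (y : E) = inner ℂ (x : E) (T y))
    (hr : ∀ lam : ℂ, DenseRange (shift T lam)) (lam : ℂ) :
    Function.Injective (shift T.closure lam) := by
  rw [injective_iff_map_eq_zero]
  intro x hx
  have key : ∀ y : T.domain, ∀ x : T.closure.domain,
      inner ℂ (T.closure x) (y : E) = inner ℂ (x : E) (T y) := by
    intro y
    exact closure_induction (P := {p : E × E | inner ℂ p.2 (y : E) = inner ℂ p.1 (T y)}) hT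
      (isClosed_eq (by fun_prop) (by fun_prop)) fun x => hs x y
  have hxe : T.closure x = lam • (x : E) := sub_eq_zero.1 hx
  -- The eigenvector x is orthogonal to the range of T - conj λ, which is dense.
  have h0 : ∀ z : E, inner ℂ (x : E) z = 0 := by
    intro z
    refine (hr ((starRingEnd ℂ) lam)).induction_on
      (p := fun z => inner ℂ (x : E) z = 0) z ?_ ?_
    · exact isClosed_eq (by fun_prop) (by fun_prop)
    · intro y
      rw [shift_apply, inner_sub_right, ← key y x, hxe, inner_smul_left, inner_smul_right, sub_self]
  exact Subtype.ext (inner_self_eq_zero.1 (h0 x))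

/-- Off the half line `[0, ∞)` a positive symmetric operator is bounded below. -/
theorem exists_lower_bound {T : E →ₗ.[ℂ] E}
    (hs : ∀ x y : T.domain, inner ℂ (T x) (y : E) = inner ℂ (x : E) (T y))
    (hp : ∀ x : T.domain, 0 ≤ (inner ℂ (x : E) (T x)).re) {lam : ℂ}
    (hlam : lam ∉ ((fun r : ℝ => (r : ℂ)) '' Set.Ici 0)) :
    ∃ C : ℝ, 0 ≤ C ∧ ∀ x : T.domain, ‖(x : E)‖ ≤ C * ‖shift T lam x‖ := by
  suffices h : ∃ d : ℝ, 0 < d ∧ ∀ x : T.domain, d * ‖(x : E)‖ ^ 2 ≤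
      ‖inner ℂ (x : E) (shift T lam x)‖ by
    obtain ⟨d, hd, h⟩ := h
    refine ⟨d⁻¹, by positivity, fun x => ?_⟩
    rcases (norm_nonneg (x : E)).eq_or_lt with h0 | h0
    · rw [← h0]; positivity
    · have h1 := (h x).trans (norm_inner_le_norm (𝕜 := ℂ) (x : E) (shift T lam x))
      rw [inv_mul_eq_div, le_div_iff₀ hd]
      nlinarith
  have hin : ∀ x : T.domain, inner ℂ (x : E) (shift T lam x) =
      inner ℂ (x : E) (T x) - lam * ((‖(x : E)‖ ^ 2 : ℝ) : ℂ) := by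
    intro x
    rw [shift_apply, inner_sub_right, inner_smul_right, inner_self_eq_norm_sq_to_K]
    push_cast
    rfl
  have him : ∀ x : T.domain, (inner ℂ (x : E) (T x)).im = 0 := by
    intro x
    have := hs x x
    rw [← inner_conj_symm] at this
    exact Complex.conj_eq_iff_im.1 this
  -- Since ⟨x, T x⟩ is real and nonnegative, the real part of the form gives d = -Re λ for negative
  -- λ, and the imaginary part gives d = |Im λ| for nonreal λ.
  by_cases hi : lam.im = 0
  · have hre : lam.re < 0 := by
      by_contra! h
      exact hlam ⟨lam.re, h, Complex.ext rfl hi.symm⟩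
    refine ⟨-lam.re, by linarith, fun x => ?_⟩
    refine le_trans ?_ (Complex.re_le_norm _)
    rw [hin, Complex.sub_re, Complex.re_mul_ofReal]
    linarith [hp x]
  · refine ⟨|lam.im|, abs_pos.2 hi, fun x => ?_⟩
    refine le_trans ?_ (Complex.abs_im_le_norm _)
    rw [hin, Complex.sub_im, Complex.im_mul_ofReal, him, zero_sub, abs_neg, abs_mul,
      abs_of_nonneg (sq_nonneg ‖(x : E)‖)]

variable [CompleteSpace E]

/-- A closed operator with dense range that is bounded below is surjective. -/
theorem surjective_shift_of_lower_bound {T : E →ₗ.[ℂ] E} (hT : T.IsClosed) {lam : ℂ}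
    (hr : DenseRange (shift T lam)) {C : ℝ}
    (hC : ∀ x : T.domain, ‖(x : E)‖ ≤ C * ‖shift T lam x‖) :
    Function.Surjective (shift T lam) := by
  intro y
  obtain ⟨u, hu, hlim⟩ := mem_closure_iff_seq_limit.1 (hr y)
  choose v hv using hu
  -- The lower bound turns convergence of the images into the Cauchy property of the preimages;
  -- closedness of the graph then identifies the limit.
  have hcs : CauchySeq (fun n => (v n : E)) := by
    have h1 : CauchySeq (fun n => (C : ℝ) • u n) := (hlim.const_smul C).cauchySeq
    rw [Metric.cauchySeq_iff] at h1 ⊢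
    intro ε hε
    obtain ⟨N, hN⟩ := h1 ε hε
    refine ⟨N, fun m hm n hn => lt_of_le_of_lt ?_ (hN m hm n hn)⟩
    rw [dist_eq_norm, dist_eq_norm, ← smul_sub, norm_smul, ← hv m, ← hv n, ← map_sub]
    refine (hC (v m - v n)).trans ?_
    gcongr
    exact Real.le_norm_self C
  obtain ⟨x, hx⟩ := cauchySeq_tendsto_of_complete hcs
  have h2 : Filter.Tendsto (fun n => T (v n)) Filter.atTop (nhds (y + lam • x)) := by
    refine (hlim.add (hx.const_smul lam)).congr fun n => ?_
    rw [← hv n, shift_apply, sub_add_cancel]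
  have h3 : (x, y + lam • x) ∈ T.graph :=
    IsClosed.mem_of_tendsto hT (hx.prodMk_nhds h2) (.of_forall fun n => T.mem_graph (v n))
  obtain ⟨x', h4, h5⟩ := (LinearPMap.mem_graph_iff T).1 h3
  refine ⟨x', ?_⟩
  rw [shift_apply, h5, h4, add_sub_cancel_right]

/-- The inverse of a bijective closed operator is bounded. -/
theorem exists_bound_of_bijective {T : E →ₗ.[ℂ] E} (hT : T.IsClosed) {lam : ℂ}
    (hb : Function.Bijective (shift T lam)) :
    ∃ C : ℝ, ∀ x : T.domain, ‖(x : E)‖ ≤ C * ‖shift T lam x‖ := by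
  let e := LinearEquiv.ofBijective (shift T lam) hb
  let S : E →ₗ[ℂ] E := T.domain.subtype ∘ₗ e.symm.toLinearMap
  have hS : ∀ x : T.domain, S (shift T lam x) = x := fun x =>
    congrArg (Subtype.val) (e.symm_apply_apply x)
  -- The closed graph theorem applies: the graph of the inverse is the preimage of the graph of T
  -- under (y, x) ↦ (x, y + λx).
  have hgraph : IsClosed (S.graph : Set (E × E)) := by
    have h1 : (S.graph : Set (E × E)) =
        (fun p : E × E => (p.2, p.1 + lam • p.2)) ⁻¹' (T.graph : Set (E × E)) := by
      ext ⟨a, b⟩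
      simp only [SetLike.mem_coe, LinearMap.mem_graph_iff, Set.mem_preimage,
        LinearPMap.mem_graph_iff]
      constructor
      · rintro rfl
        obtain ⟨x, rfl⟩ := hb.2 a
        refine ⟨x, (hS x).symm, ?_⟩
        rw [hS, shift_apply, sub_add_cancel]
      · rintro ⟨x, rfl, h⟩
        have : a = shift T lam x := by rw [shift_apply, h, add_sub_cancel_right]
        rw [this, hS]
    rw [h1]
    exact IsClosed.preimage (by fun_prop) hT
  let S' : E →L[ℂ] E := ⟨S, S.continuous_of_isClosed_graph hgraph⟩
  refine ⟨‖S'‖, fun x => ?_⟩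
  have := S'.le_opNorm (shift T lam x)
  rwa [show S' (shift T lam x) = x from hS x] at this

/-- The spectrum of a positive symmetric operator all of whose shifts have dense range and which
has approximate eigenvectors for every nonnegative real number. -/
theorem spectrum_closure_eq {T : E →ₗ.[ℂ] E} (hd : Dense (T.domain : Set E))
    (hs : ∀ x y : T.domain, inner ℂ (T x) (y : E) = inner ℂ (x : E) (T y))
    (hp : ∀ x : T.domain, 0 ≤ (inner ℂ (x : E) (T x)).re)
    (hr : ∀ lam : ℂ, DenseRange (shift T lam))
    (ha : ∀ r : ℝ, 0 ≤ r → ∀ ε : ℝ, 0 < ε →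
      ∃ x : T.domain, x ≠ 0 ∧ ‖shift T r x‖ ≤ ε * ‖(x : E)‖) :
    spectrum T.closure = ((fun r : ℝ => (r : ℂ)) '' Set.Ici 0) ∧
      continuousSpectrum T.closure = ((fun r : ℝ => (r : ℂ)) '' Set.Ici 0) := by
  have hT := isClosable_of_symmetric hd hs
  have hinj := injective_shift_closure hT hs hr
  have hdr : ∀ lam : ℂ, DenseRange (shift T.closure lam) := fun lam =>
    (hr lam).mono (range_shift_subset_closure T lam)
  have hlow : ∀ lam : ℂ, lam ∉ ((fun r : ℝ => (r : ℂ)) '' Set.Ici 0) →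
      ∃ C : ℝ, ∀ x : T.closure.domain, ‖(x : E)‖ ≤ C * ‖shift T.closure lam x‖ := by
    intro lam hlam
    obtain ⟨C, -, hC⟩ := exists_lower_bound hs hp hlam
    refine ⟨C, ?_⟩
    exact closure_induction (P := {p : E × E | ‖p.1‖ ≤ C * ‖p.2 - lam • p.1‖}) hT
      (isClosed_le (by fun_prop) (by fun_prop)) hC
  have hunb : ∀ lam ∈ ((fun r : ℝ => (r : ℂ)) '' Set.Ici 0),
      ¬ ∃ C : ℝ, ∀ x : T.closure.domain, ‖(x : E)‖ ≤ C * ‖shift T.closure lam x‖ := by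
    rintro _ ⟨r, hr0, rfl⟩ ⟨C, hC⟩
    -- With this ε the supposed bound C would give ‖x‖ ≤ ‖x‖ / 2; the added 1 covers C = 0.
    obtain ⟨x, hx0, hx⟩ := ha r hr0 (1 / (2 * (|C| + 1))) (by positivity)
    obtain ⟨x', h1, h2⟩ := exists_closure_extension T x
    have h3 := hC x'
    rw [shift_apply, h1, h2, ← shift_apply] at h3
    have hx0' : 0 < ‖(x : E)‖ := by
      rw [norm_pos_iff]; exact fun h => hx0 (Subtype.ext h)
    have h4 : ‖(x : E)‖ ≤ (|C| + 1) * ((1 / (2 * (|C| + 1))) * ‖(x : E)‖) := by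
      refine h3.trans ((mul_le_mul_of_nonneg_left hx (by positivity)).trans' ?_)
      gcongr
      linarith [le_abs_self C]
    have h5 : (|C| + 1) * ((1 / (2 * (|C| + 1))) * ‖(x : E)‖) = ‖(x : E)‖ / 2 := by
      field_simp
    linarith
  constructor
  · ext lam
    constructor
    · intro h
      by_contra hlam
      obtain ⟨C, hC⟩ := hlow lam hlam
      exact h ⟨hinj lam, surjective_shift_of_lower_bound hT.closure_isClosed (hdr lam) hC⟩
    · intro h hb
      exact hunb lam h (exists_bound_of_bijective hT.closure_isClosed hb)
  · ext lam
    constructor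
    · rintro ⟨-, -, h⟩
      by_contra hlam
      exact h (hlow lam hlam)
    · exact fun h => ⟨hinj lam, hdr lam, hunb lam h⟩

end SymmetricOperators

/-! ### Symmetry and positivity by integration by parts. -/

section IntegrationByParts

theorem inner_schwartzToL2 (f g : 𝓢(H3, ℂ)) :
    inner ℂ (schwartzToL2 f) (schwartzToL2 g) = ∫ p, inner ℂ (f p) (g p) :=
  SchwartzMap.inner_toL2_toL2_eq f g

/-- The real inner product pairing as a real bilinear map. -/
def innerBilin : ℂ →L[ℝ] ℂ →L[ℝ] ℂ :=
  (ContinuousLinearMap.mul ℝ ℂ).comp (Complex.conjCLE : ℂ →L[ℝ] ℂ)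

theorem innerBilin_apply (a b : ℂ) : innerBilin a b = inner ℂ a b := by
  simp [innerBilin, mul_comm]

theorem inner_lineDerivOp_right (f g : 𝓢(H3, ℂ)) (v : H3) :
    inner ℂ (schwartzToL2 f) (schwartzToL2 (lineDerivOpCLM ℂ 𝓢(H3, ℂ) v g)) =
      -inner ℂ (schwartzToL2 (lineDerivOpCLM ℂ 𝓢(H3, ℂ) v f)) (schwartzToL2 g) := by
  have h := SchwartzMap.integral_bilinear_lineDerivOp_right_eq_neg_left (μ := (volume : Measure H3))
    f g innerBilin v
  simp only [innerBilin_apply] at h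
  rw [inner_schwartzToL2, inner_schwartzToL2]
  exact h

theorem inner_smulLeft_right {c : H3 → ℝ} (hc : (fun p => (c p : ℂ)).HasTemperateGrowth)
    (f g : 𝓢(H3, ℂ)) :
    inner ℂ (schwartzToL2 f) (schwartzToL2 (SchwartzMap.smulLeftCLM ℂ (fun p => (c p : ℂ)) g)) =
      inner ℂ (schwartzToL2 (SchwartzMap.smulLeftCLM ℂ (fun p => (c p : ℂ)) f))
        (schwartzToL2 g) := by
  rw [inner_schwartzToL2, inner_schwartzToL2]
  congr 1
  ext p
  rw [SchwartzMap.smulLeftCLM_apply_apply hc, SchwartzMap.smulLeftCLM_apply_apply hc,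
    inner_smul_left, inner_smul_right, Complex.conj_ofReal]

/-- A vector field `∂_v + c ∂_t`, with `c` real and independent of `t`, is skew-symmetric. -/
theorem inner_vectorField_right (l : ℂ →L[ℝ] ℝ) (v : H3) (f g : 𝓢(H3, ℂ)) :
    inner ℂ (schwartzToL2 f) (schwartzToL2 (lineDerivOpCLM ℂ 𝓢(H3, ℂ) v g +
      SchwartzMap.smulLeftCLM ℂ (fun p : H3 => (l p.1 : ℂ))
        (lineDerivOpCLM ℂ 𝓢(H3, ℂ) ((0, 1) : H3) g))) =
    -inner ℂ (schwartzToL2 (lineDerivOpCLM ℂ 𝓢(H3, ℂ) v f +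
      SchwartzMap.smulLeftCLM ℂ (fun p : H3 => (l p.1 : ℂ))
        (lineDerivOpCLM ℂ 𝓢(H3, ℂ) ((0, 1) : H3) f))) (schwartzToL2 g) := by
  have hc : (fun p : H3 => (l p.1 : ℂ)).HasTemperateGrowth :=
    (Complex.ofRealCLM ∘L (l ∘L ContinuousLinearMap.fst ℝ ℂ ℝ)).hasTemperateGrowth
  have hcomm : lineDerivOpCLM ℂ 𝓢(H3, ℂ) ((0, 1) : H3)
      (SchwartzMap.smulLeftCLM ℂ (fun p : H3 => (l p.1 : ℂ)) f) =
      SchwartzMap.smulLeftCLM ℂ (fun p : H3 => (l p.1 : ℂ))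
        (lineDerivOpCLM ℂ 𝓢(H3, ℂ) ((0, 1) : H3) f) := by
    ext p
    rw [SchwartzMap.smulLeftCLM_apply_apply hc, lineDerivOpCLM_apply, lineDerivOpCLM_apply,
      SchwartzMap.lineDerivOp_apply_eq_fderiv, SchwartzMap.lineDerivOp_apply_eq_fderiv,
      SchwartzMap.smulLeftCLM_apply hc]
    have h1 : HasFDerivAt (fun p : H3 => (l p.1 : ℂ))
        (Complex.ofRealCLM ∘L (l ∘L ContinuousLinearMap.fst ℝ ℂ ℝ)) p :=
      (Complex.ofRealCLM ∘L (l ∘L ContinuousLinearMap.fst ℝ ℂ ℝ)).hasFDerivAt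
    have h2 := h1.smul (f.hasFDerivAt p)
    have h3 := h2.fderiv
    rw [show (fun x : H3 => (l x.1 : ℂ) • f x) = ((fun p : H3 => (l p.1 : ℂ)) • ⇑f) from rfl, h3]
    simp
  rw [map_add, map_add, inner_add_left, inner_add_right, inner_lineDerivOp_right,
    inner_smulLeft_right hc, inner_lineDerivOp_right, hcomm]
  ring

theorem inner_X_right (f g : 𝓢(H3, ℂ)) :
    inner ℂ (schwartzToL2 f) (schwartzToL2 (X g)) =
      -inner ℂ (schwartzToL2 (X f)) (schwartzToL2 g) := by
  have h : (fun p : H3 => ((2 * p.1.im : ℝ) : ℂ)).HasTemperateGrowth :=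
    (Complex.ofRealCLM ∘L ((2 : ℝ) • (Complex.imCLM ∘L ContinuousLinearMap.fst ℝ ℂ ℝ))
      ).hasTemperateGrowth
  have hX : ∀ u, X u = lineDerivOpCLM ℂ 𝓢(H3, ℂ) ((1, 0) : H3) u +
      SchwartzMap.smulLeftCLM ℂ (fun p : H3 => ((((-2 : ℝ) • Complex.imCLM) p.1 : ℝ) : ℂ))
        (lineDerivOpCLM ℂ 𝓢(H3, ℂ) ((0, 1) : H3) u) := by
    intro u
    have : (fun p : H3 => ((((-2 : ℝ) • Complex.imCLM) p.1 : ℝ) : ℂ)) =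
        fun p : H3 => -((2 * p.1.im : ℝ) : ℂ) := by
      ext p; simp
    rw [this, SchwartzMap.smulLeftCLM_fun_neg h]
    exact sub_eq_add_neg _ _
  rw [hX, hX]
  exact inner_vectorField_right _ _ f g

theorem inner_Y_right (f g : 𝓢(H3, ℂ)) :
    inner ℂ (schwartzToL2 f) (schwartzToL2 (Y g)) =
      -inner ℂ (schwartzToL2 (Y f)) (schwartzToL2 g) :=
  inner_vectorField_right ((2 : ℝ) • Complex.reCLM) (Complex.I, 0) f g

/-- Skew-symmetry of X and Y moves one copy of each field to the left. The resulting Dirichlet form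
is Hermitian, which gives symmetry, and nonnegative on the diagonal, which gives positivity. -/
theorem inner_subLaplacianSchwartz_right (f g : 𝓢(H3, ℂ)) :
    inner ℂ (schwartzToL2 f) (schwartzToL2 (subLaplacianSchwartz g)) =
      inner ℂ (schwartzToL2 (X f)) (schwartzToL2 (X g)) +
        inner ℂ (schwartzToL2 (Y f)) (schwartzToL2 (Y g)) := by
  have h : subLaplacianSchwartz g = -(X (X g) + Y (Y g)) := rfl
  rw [h, map_neg, map_add, inner_neg_right, inner_add_right, inner_X_right, inner_Y_right]
  ring

theorem exists_eq_schwartzToL2 (x : subLaplacian.domain) :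
    ∃ u : 𝓢(H3, ℂ), x = ⟨schwartzToL2 u, LinearMap.mem_range_self schwartzToL2 u⟩ := by
  obtain ⟨u, hu⟩ := x.2
  exact ⟨u, Subtype.ext hu.symm⟩

theorem subLaplacian_symmetric (x y : subLaplacian.domain) :
    inner ℂ (subLaplacian x) (y : L2) = inner ℂ (x : L2) (subLaplacian y) := by
  obtain ⟨f, rfl⟩ := exists_eq_schwartzToL2 x
  obtain ⟨g, rfl⟩ := exists_eq_schwartzToL2 y
  rw [subLaplacian_apply, subLaplacian_apply, inner_subLaplacianSchwartz_right,
    ← inner_conj_symm, inner_subLaplacianSchwartz_right, map_add, inner_conj_symm,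
    inner_conj_symm]

theorem subLaplacian_nonneg (x : subLaplacian.domain) :
    0 ≤ (inner ℂ (x : L2) (subLaplacian x)).re := by
  obtain ⟨f, rfl⟩ := exists_eq_schwartzToL2 x
  rw [subLaplacian_apply, inner_subLaplacianSchwartz_right, Complex.add_re]
  exact add_nonneg (inner_self_nonneg (𝕜 := ℂ)) (inner_self_nonneg (𝕜 := ℂ))

theorem dense_subLaplacian_domain : Dense (subLaplacian.domain : Set L2) :=
  SchwartzMap.denseRange_toLpCLM (E := H3) (F := ℂ) (p := 2) (μ := volume) (by simp)

end IntegrationByParts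

/-! ### Conjugation by the Fourier transform. -/

section FrequencySide

open scoped FourierTransform Real

/-- The frequency space, with points `(ζ, τ)` and its Euclidean structure. -/
abbrev Freq : Type := WithLp 2 (ℂ × ℝ)

/-- The linear identification of the frequency space with `ℂ × ℝ`. -/
abbrev freqEquiv : Freq ≃L[ℝ] H3 := WithLp.prodContinuousLinearEquiv 2 ℝ ℂ ℝ

/-- The inverse Fourier transform, from functions of the frequency to functions on the group. -/
def synthesis (v : 𝓢(Freq, ℂ)) : 𝓢(H3, ℂ) :=
  SchwartzMap.compCLMOfContinuousLinearEquiv ℂ freqEquiv.symm (𝓕⁻ v)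

theorem synthesis_add (v w : 𝓢(Freq, ℂ)) : synthesis (v + w) = synthesis v + synthesis w := by
  rw [synthesis, FourierTransform.fourierInv_add, map_add]; rfl

theorem synthesis_smul (c : ℂ) (v : 𝓢(Freq, ℂ)) : synthesis (c • v) = c • synthesis v := by
  rw [synthesis, FourierTransform.fourierInv_smul, map_smul]; rfl

theorem synthesis_sub (v w : 𝓢(Freq, ℂ)) : synthesis (v - w) = synthesis v - synthesis w := by
  rw [sub_eq_add_neg, ← neg_one_smul ℂ w, synthesis_add, synthesis_smul, neg_one_smul,
    sub_eq_add_neg]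

theorem synthesis_neg (v : 𝓢(Freq, ℂ)) : synthesis (-v) = -synthesis v := by
  rw [← neg_one_smul ℂ v, synthesis_smul, neg_one_smul]

theorem synthesis_surjective : Function.Surjective synthesis := by
  intro u
  refine ⟨𝓕 (SchwartzMap.compCLMOfContinuousLinearEquiv ℂ freqEquiv u), ?_⟩
  rw [synthesis, FourierTransform.fourierInv_fourier_eq]
  ext p
  rfl

/-- Plancherel, together with the fact that passing from the Euclidean structure to the product ℂ ×
ℝ preserves volume. Density and approximate eigenvectors can therefore be treated in frequency. -/
theorem norm_schwartzToL2_synthesis (v : 𝓢(Freq, ℂ)) :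
    ‖schwartzToL2 (synthesis v)‖ = ‖v.toLp 2 volume‖ := by
  have h1 : ‖(𝓕⁻ v).toLp 2 volume‖ = ‖v.toLp 2 volume‖ := by
    have h0 : (𝓕 (𝓕⁻ v : 𝓢(Freq, ℂ)) : 𝓢(Freq, ℂ)) = v :=
      FourierTransform.fourier_fourierInv_eq v
    conv_rhs => rw [← h0]
    exact (SchwartzMap.norm_fourier_toL2_eq (𝓕⁻ v)).symm
  rw [← h1]
  change ‖(synthesis v).toLp 2 volume‖ = _
  rw [SchwartzMap.norm_toLp, SchwartzMap.norm_toLp]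
  have h2 : ⇑(synthesis v) = (⇑(𝓕⁻ v : 𝓢(Freq, ℂ))) ∘ WithLp.toLp 2 := rfl
  rw [h2, eLpNorm_comp_measurePreserving (g := ⇑(𝓕⁻ v : 𝓢(Freq, ℂ))) (μ := volume) (ν := volume)
    (SchwartzMap.continuous _).aestronglyMeasurable (WithLp.volume_preserving_toLp ℂ ℝ)]

theorem lineDerivOp_synthesis (m : H3) (v : 𝓢(Freq, ℂ)) :
    lineDerivOpCLM ℂ 𝓢(H3, ℂ) m (synthesis v) =
      synthesis ((2 * π * Complex.I) •
        SchwartzMap.smulLeftCLM ℂ (inner ℝ · (freqEquiv.symm m)) v) := by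
  rw [lineDerivOpCLM_apply, synthesis, SchwartzMap.lineDerivOp_compCLMOfContinuousLinearEquiv,
    SchwartzMap.lineDerivOp_fourierInv_eq]
  rfl

theorem smulLeft_synthesis (m : H3) (v : 𝓢(Freq, ℂ)) :
    (2 * π * Complex.I) • SchwartzMap.smulLeftCLM ℂ
      (fun p : H3 => inner ℝ (freqEquiv.symm p) (freqEquiv.symm m)) (synthesis v) =
      -synthesis (∂_{freqEquiv.symm m} v) := by
  have h : (fun p : H3 => inner ℝ (freqEquiv.symm p) (freqEquiv.symm m)).HasTemperateGrowth := by
    exact (((innerSL ℝ).flip (freqEquiv.symm m)) ∘L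
      (freqEquiv.symm : H3 →L[ℝ] Freq)).hasTemperateGrowth
  rw [synthesis, SchwartzMap.smulLeftCLM_compCLMOfContinuousLinearEquiv ℂ h, synthesis,
    SchwartzMap.fourierInv_lineDerivOp_eq, map_smul, neg_smul, neg_neg]
  rfl

theorem hasTemperateGrowth_ofReal_clm {F : Type*} [NormedAddCommGroup F] [NormedSpace ℝ F]
    (l : F →L[ℝ] ℝ) : (fun p => (l p : ℂ)).HasTemperateGrowth :=
  (Complex.ofRealCLM ∘L l).hasTemperateGrowth

/-- The coordinate `Re ζ` on the frequency space. -/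
def freqRe : Freq →L[ℝ] ℝ := Complex.reCLM ∘L ContinuousLinearMap.fst ℝ ℂ ℝ ∘L freqEquiv

/-- The coordinate `Im ζ` on the frequency space. -/
def freqIm : Freq →L[ℝ] ℝ := Complex.imCLM ∘L ContinuousLinearMap.fst ℝ ℂ ℝ ∘L freqEquiv

/-- The coordinate `τ` on the frequency space. -/
def freqT : Freq →L[ℝ] ℝ := ContinuousLinearMap.snd ℝ ℂ ℝ ∘L freqEquiv

/-- Multiplication by a real linear form. -/
def mulForm (l : Freq →L[ℝ] ℝ) (v : 𝓢(Freq, ℂ)) : 𝓢(Freq, ℂ) :=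
  SchwartzMap.smulLeftCLM ℂ (fun w => (l w : ℂ)) v

theorem mulForm_apply (l : Freq →L[ℝ] ℝ) (v : 𝓢(Freq, ℂ)) (w : Freq) :
    mulForm l v w = l w * v w := by
  rw [mulForm, SchwartzMap.smulLeftCLM_apply_apply (hasTemperateGrowth_ofReal_clm l), smul_eq_mul]

/-- The field `X` on the frequency side. -/
def freqX (v : 𝓢(Freq, ℂ)) : 𝓢(Freq, ℂ) :=
  (2 * π * Complex.I) • mulForm freqRe v +
    (2 : ℂ) • ∂_{freqEquiv.symm ((Complex.I, 0) : H3)} (mulForm freqT v)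

/-- The field `Y` on the frequency side. -/
def freqY (v : 𝓢(Freq, ℂ)) : 𝓢(Freq, ℂ) :=
  (2 * π * Complex.I) • mulForm freqIm v -
    (2 : ℂ) • ∂_{freqEquiv.symm ((1, 0) : H3)} (mulForm freqT v)

/-- The sub-Laplacian on the frequency side. -/
def freqSubLaplacian (v : 𝓢(Freq, ℂ)) : 𝓢(Freq, ℂ) :=
  -(freqX (freqX v) + freqY (freqY v))

theorem lineDerivOp_synthesis' {m : H3} {l : Freq →L[ℝ] ℝ}
    (hl : ∀ w, inner ℝ w (freqEquiv.symm m) = l w) (v : 𝓢(Freq, ℂ)) :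
    lineDerivOpCLM ℂ 𝓢(H3, ℂ) m (synthesis v) =
      synthesis ((2 * π * Complex.I) • mulForm l v) := by
  rw [lineDerivOp_synthesis, mulForm, show (inner ℝ · (freqEquiv.symm m)) = l from funext hl]
  congr 2
  exact (SchwartzMap.smulLeftCLM_ofReal ℂ l.hasTemperateGrowth v).symm

theorem smulLeft_synthesis' {m : H3} {c : H3 → ℝ} (l : H3 →L[ℝ] ℝ)
    (hl : ∀ p, inner ℝ (freqEquiv.symm p) (freqEquiv.symm m) = l p) (hc : ∀ p, c p = 2 * l p)
    (v : 𝓢(Freq, ℂ)) :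
    SchwartzMap.smulLeftCLM ℂ (fun p : H3 => (c p : ℂ))
      (synthesis ((2 * π * Complex.I) • v)) = -(2 : ℂ) • synthesis (∂_{freqEquiv.symm m} v) := by
  have h := smulLeft_synthesis m v
  rw [neg_smul, ← smul_neg, ← h, synthesis_smul, map_smul, smul_comm (2 : ℂ)]
  congr 1
  ext p
  rw [smul_apply, SchwartzMap.smulLeftCLM_apply_apply, funext hl,
    SchwartzMap.smulLeftCLM_apply_apply l.hasTemperateGrowth, hc, smul_eq_mul, smul_eq_mul,
    Complex.real_smul]
  · push_cast; ring
  · rw [show c = fun p => ((2 : ℝ) • l) p from funext hc]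
    exact hasTemperateGrowth_ofReal_clm _

theorem X_synthesis (v : 𝓢(Freq, ℂ)) : X (synthesis v) = synthesis (freqX v) := by
  have h1 : ∀ w : Freq, inner ℝ w (freqEquiv.symm ((1, 0) : H3)) = freqRe w := by
    intro w; simp [WithLp.prod_inner_apply, freqRe, Complex.inner]
  have h2 : ∀ w : Freq, inner ℝ w (freqEquiv.symm ((0, 1) : H3)) = freqT w := by
    intro w; simp [WithLp.prod_inner_apply, freqT]
  have h3 : ∀ p : H3, inner ℝ (freqEquiv.symm p) (freqEquiv.symm ((Complex.I, 0) : H3)) =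
      (Complex.imCLM ∘L ContinuousLinearMap.fst ℝ ℂ ℝ) p := by
    intro w; simp [WithLp.prod_inner_apply, Complex.inner]
  have h : X (synthesis v) = lineDerivOpCLM ℂ 𝓢(H3, ℂ) ((1, 0) : H3) (synthesis v) -
      (SchwartzMap.smulLeftCLM ℂ (fun p : H3 => ((2 * p.1.im : ℝ) : ℂ)))
        (lineDerivOpCLM ℂ 𝓢(H3, ℂ) ((0, 1) : H3) (synthesis v)) := rfl
  rw [h, lineDerivOp_synthesis' h1, lineDerivOp_synthesis' h2,
    smulLeft_synthesis' (c := fun p => 2 * p.1.im) _ h3 (fun p => rfl), neg_smul, sub_neg_eq_add, ← synthesis_smul,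
    ← synthesis_add]
  rfl

theorem Y_synthesis (v : 𝓢(Freq, ℂ)) : Y (synthesis v) = synthesis (freqY v) := by
  have h1 : ∀ w : Freq, inner ℝ w (freqEquiv.symm ((Complex.I, 0) : H3)) = freqIm w := by
    intro w; simp [WithLp.prod_inner_apply, freqIm, Complex.inner]
  have h2 : ∀ w : Freq, inner ℝ w (freqEquiv.symm ((0, 1) : H3)) = freqT w := by
    intro w; simp [WithLp.prod_inner_apply, freqT]
  have h3 : ∀ p : H3, inner ℝ (freqEquiv.symm p) (freqEquiv.symm ((1, 0) : H3)) =
      (Complex.reCLM ∘L ContinuousLinearMap.fst ℝ ℂ ℝ) p := by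
    intro w; simp [WithLp.prod_inner_apply, Complex.inner]
  have h : Y (synthesis v) = lineDerivOpCLM ℂ 𝓢(H3, ℂ) ((Complex.I, 0) : H3) (synthesis v) +
      (SchwartzMap.smulLeftCLM ℂ (fun p : H3 => ((2 * p.1.re : ℝ) : ℂ)))
        (lineDerivOpCLM ℂ 𝓢(H3, ℂ) ((0, 1) : H3) (synthesis v)) := rfl
  rw [h, lineDerivOp_synthesis' h1, lineDerivOp_synthesis' h2,
    smulLeft_synthesis' (c := fun p => 2 * p.1.re) _ h3 (fun p => rfl), neg_smul, ← sub_eq_add_neg, ← synthesis_smul,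
    ← synthesis_sub]
  rfl

theorem subLaplacianSchwartz_synthesis (v : 𝓢(Freq, ℂ)) :
    subLaplacianSchwartz (synthesis v) = synthesis (freqSubLaplacian v) := by
  have h : subLaplacianSchwartz (synthesis v) =
    -(X (X (synthesis v)) + Y (Y (synthesis v))) := rfl
  rw [h, X_synthesis, X_synthesis, Y_synthesis, Y_synthesis, ← synthesis_add, ← synthesis_neg]
  rfl

end FrequencySide

/-! ### A criterion for being a Schwartz function. -/

section SchwartzCriterion

open scoped ContDiff

variable {V : Type*} [NormedAddCommGroup V] [NormedSpace ℝ V] [FiniteDimensional ℝ V]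

/-- A space of smooth rapidly decaying functions that is stable under directional derivatives
consists of Schwartz functions. -/
theorem decay_iteratedFDeriv_of_stable (S : Submodule ℂ (V → ℂ))
    (hsmooth : ∀ f ∈ S, ContDiff ℝ ∞ f)
    (hdecay : ∀ f ∈ S, ∀ k : ℕ, ∃ C, ∀ x, ‖x‖ ^ k * ‖f x‖ ≤ C)
    (hderiv : ∀ f ∈ S, ∀ m : V, (fun x => fderiv ℝ f x m) ∈ S) (k n : ℕ) :
    ∀ f ∈ S, ∃ C, ∀ x, ‖x‖ ^ k * ‖iteratedFDeriv ℝ n f x‖ ≤ C := by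
  induction n with
  | zero =>
    intro f hf
    simpa only [norm_iteratedFDeriv_zero] using hdecay f hf k
  | succ n ih =>
    intro f hf
    let b := Module.finBasis ℝ V
    let coord : Fin (Module.finrank ℝ V) → (V →L[ℝ] ℝ) := fun i =>
      LinearMap.toContinuousLinearMap (b.coord i)
    let L : Fin (Module.finrank ℝ V) → (ℂ →L[ℝ] (V →L[ℝ] ℂ)) := fun i =>
      ContinuousLinearMap.smulRightL ℝ V ℂ (coord i)
    -- Expanding the differential in a basis reduces derivatives of order n + 1 of f to derivatives
    -- of order n of its partial derivatives, which lie in S again.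
    have hsum : fderiv ℝ f = fun x => ∑ i, (L i ∘ fun x => fderiv ℝ f x (b i)) x := by
      ext x m
      have hm : m = ∑ i, coord i m • b i := (b.sum_repr m).symm
      conv_lhs => rw [hm]
      simp [L]
    choose C hC using fun i => ih _ (hderiv f hf (b i))
    refine ⟨∑ i, ‖L i‖ * C i, fun x => ?_⟩
    have hg : ∀ i, ContDiff ℝ n (fun x => fderiv ℝ f x (b i)) := fun i =>
      (hsmooth _ (hderiv f hf (b i))).of_le (by exact_mod_cast le_top)
    rw [← norm_iteratedFDeriv_fderiv, hsum, iteratedFDeriv_fun_sum_apply]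
    · calc ‖x‖ ^ k * ‖∑ i, iteratedFDeriv ℝ n (L i ∘ fun x => fderiv ℝ f x (b i)) x‖
          ≤ ‖x‖ ^ k * ∑ i, ‖L i‖ * ‖iteratedFDeriv ℝ n (fun x => fderiv ℝ f x (b i)) x‖ := by
            gcongr
            refine (norm_sum_le _ _).trans (Finset.sum_le_sum fun i _ => ?_)
            exact (L i).norm_iteratedFDeriv_comp_left (hg i).contDiffAt le_rfl
        _ = ∑ i, ‖L i‖ * (‖x‖ ^ k * ‖iteratedFDeriv ℝ n (fun x => fderiv ℝ f x (b i)) x‖) := by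
            rw [Finset.mul_sum]
            exact Finset.sum_congr rfl fun i _ => by ring
        _ ≤ ∑ i, ‖L i‖ * C i := by
            gcongr with i
            exact hC i x
    · intro i _
      exact ((L i).contDiff.comp (hg i)).contDiffAt

end SchwartzCriterion

/-! ### Gaussian monomials and their derivatives. -/

section GaussianMonomials

open scoped ContDiff

/-- Off its support the function is locally zero. Hence factors singular at τ = 0 do no harm next to
a bump that vanishes near 0. -/
theorem contDiff_of_contDiffAt_tsupport {V : Type*} [NormedAddCommGroup V] [NormedSpace ℝ V]
    {f : V → ℂ} (h : ∀ x ∈ tsupport f, ContDiffAt ℝ ∞ f x) : ContDiff ℝ ∞ f := by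
  refine contDiff_iff_contDiffAt.2 fun x => ?_
  by_cases hx : x ∈ tsupport f
  · exact h x hx
  · exact (contDiffAt_const (c := (0 : ℂ))).congr_of_eventuallyEq
      (notMem_tsupport_iff_eventuallyEq.1 hx)

/-- Smooth compactly supported functions on the line, supported in `O \ {0}`. -/
structure IsBump (O : Set ℝ) (ψ : ℝ → ℂ) : Prop where
  contDiff : ContDiff ℝ ∞ ψ
  compact : HasCompactSupport ψ
  subset : tsupport ψ ⊆ O \ {0}

variable {O : Set ℝ} {ψ : ℝ → ℂ}

theorem IsBump.apply_zero (h : IsBump O ψ) : ψ 0 = 0 :=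
  image_eq_zero_of_notMem_tsupport fun h0 => (h.subset h0).2 rfl

theorem IsBump.mono {O' : Set ℝ} (h : IsBump O ψ) (hO : O ⊆ O') : IsBump O' ψ :=
  ⟨h.contDiff, h.compact, h.subset.trans (Set.sdiff_subset_sdiff_left hO)⟩

theorem IsBump.mul (h : IsBump O ψ) {ρ : ℝ → ℂ}
    (hρ : ∀ x ∈ O, x ≠ 0 → ContDiffAt ℝ ∞ ρ x) : IsBump O (fun x => ρ x * ψ x) := by
  have hs : tsupport (fun x => ρ x * ψ x) ⊆ tsupport ψ := tsupport_mul_subset_right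
  refine ⟨contDiff_of_contDiffAt_tsupport fun x hx => ?_, h.compact.mul_left, hs.trans h.subset⟩
  have := h.subset (hs hx)
  exact (hρ x this.1 this.2).mul h.contDiff.contDiffAt

theorem IsBump.deriv (h : IsBump O ψ) : IsBump O (deriv ψ) :=
  ⟨(contDiff_infty_iff_deriv.1 h.contDiff).2, h.compact.deriv,
    tsupport_deriv_subset.trans h.subset⟩

theorem contDiffAt_ofReal {ρ : ℝ → ℝ} {x : ℝ} (h : ContDiffAt ℝ ∞ ρ x) :
    ContDiffAt ℝ ∞ (fun x => (ρ x : ℂ)) x :=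
  Complex.ofRealCLM.contDiff.contDiffAt.comp x h

theorem contDiffAt_abs_inv {x : ℝ} (hx : x ≠ 0) : ContDiffAt ℝ ∞ (fun x : ℝ => |x|⁻¹) x :=
  (contDiffAt_abs hx).inv (abs_ne_zero.2 hx)

/-- Multipliers needed later: |τ|⁻¹ and τ|τ|⁻³ (minus the derivative of |τ|⁻¹) arise from
differentiating the Gaussian, τ and 1 ± sgn τ from the ladder operators. -/
theorem IsBump.mul_abs_inv (h : IsBump O ψ) : IsBump O (fun x => ((|x|⁻¹ : ℝ) : ℂ) * ψ x) :=
  h.mul fun _ _ hx => contDiffAt_ofReal (contDiffAt_abs_inv hx)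

theorem IsBump.mul_abs_inv_cube (h : IsBump O ψ) :
    IsBump O (fun x => ((x * |x|⁻¹ ^ 3 : ℝ) : ℂ) * ψ x) :=
  h.mul fun _ _ hx => contDiffAt_ofReal (contDiffAt_id.mul ((contDiffAt_abs_inv hx).pow 3))

theorem IsBump.mul_id (h : IsBump O ψ) : IsBump O (fun x => (x : ℂ) * ψ x) :=
  h.mul fun _ _ _ => contDiffAt_ofReal contDiffAt_id

theorem IsBump.mul_one_add_sign (h : IsBump O ψ) (c : ℝ) :
    IsBump O (fun x => ((1 + c * (x * |x|⁻¹) : ℝ) : ℂ) * ψ x) :=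
  h.mul fun _ _ hx => contDiffAt_ofReal
    (contDiffAt_const.add (contDiffAt_const.mul (contDiffAt_id.mul (contDiffAt_abs_inv hx))))

/-- The coordinate `ζ` of the frequency space. -/
def coordZ : Freq →L[ℝ] ℂ := WithLp.fstL 2 ℝ ℂ ℝ

/-- The conjugate coordinate of `ζ`. -/
def coordZbar : Freq →L[ℝ] ℂ := (Complex.conjCLE : ℂ →L[ℝ] ℂ) ∘L coordZ

/-- The coordinate `τ` as a complex valued map. -/
def coordT : Freq →L[ℝ] ℂ := Complex.ofRealCLM ∘L freqT

theorem coordZbar_apply (w : Freq) : coordZbar w = (starRingEnd ℂ) (coordZ w) := rfl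

/-- The function `ψ(τ) ζ^a (conj ζ)^b exp(-κ |ζ|² / |τ|)`. -/
def gaussFun (κ : ℝ) (ψ : ℝ → ℂ) (a b : ℕ) (w : Freq) : ℂ :=
  ψ (freqT w) * coordZ w ^ a * coordZbar w ^ b *
    Complex.exp (-(κ : ℂ) * (coordZ w * coordZbar w) * ((|freqT w|⁻¹ : ℝ) : ℂ))

theorem gaussFun_of_eq_zero (κ : ℝ) (a b : ℕ) {w : Freq} (h : ψ (freqT w) = 0) :
    gaussFun κ ψ a b w = 0 := by
  simp [gaussFun, h]

theorem gaussFun_mul (κ : ℝ) (ρ : ℝ → ℂ) (a b : ℕ) (w : Freq) :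
    gaussFun κ (fun x => ρ x * ψ x) a b w = ρ (freqT w) * gaussFun κ ψ a b w := by
  simp only [gaussFun]; ring

theorem gaussFun_succ_left (κ : ℝ) (a b : ℕ) (w : Freq) :
    gaussFun κ ψ (a + 1) b w = coordZ w * gaussFun κ ψ a b w := by
  simp only [gaussFun]; ring

theorem gaussFun_succ_right (κ : ℝ) (a b : ℕ) (w : Freq) :
    gaussFun κ ψ a (b + 1) w = coordZbar w * gaussFun κ ψ a b w := by
  simp only [gaussFun]; ring

theorem tsupport_gaussFun_subset (κ : ℝ) (ψ : ℝ → ℂ) (a b : ℕ) :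
    tsupport (gaussFun κ ψ a b) ⊆ freqT ⁻¹' tsupport ψ := by
  refine closure_minimal (fun w hw => subset_closure fun h => hw ?_)
    ((isClosed_tsupport ψ).preimage freqT.continuous)
  exact gaussFun_of_eq_zero κ a b h

theorem contDiff_gaussFun (hψ : IsBump O ψ) (κ : ℝ) (a b : ℕ) :
    ContDiff ℝ ∞ (gaussFun κ ψ a b) := by
  refine contDiff_of_contDiffAt_tsupport fun w hw => ?_
  have h0 : freqT w ≠ 0 := (hψ.subset (tsupport_gaussFun_subset κ ψ a b hw)).2
  have h1 : ContDiffAt ℝ ∞ (fun w => ((|freqT w|⁻¹ : ℝ) : ℂ)) w :=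
    (contDiffAt_ofReal (contDiffAt_abs_inv h0)).comp w freqT.contDiff.contDiffAt
  have h2 : ContDiffAt ℝ ∞ (fun w => ψ (freqT w)) w :=
    (hψ.contDiff.comp freqT.contDiff).contDiffAt
  have h3 : ContDiffAt ℝ ∞ (fun w => coordZ w) w := coordZ.contDiff.contDiffAt
  have h4 : ContDiffAt ℝ ∞ (fun w => coordZbar w) w := coordZbar.contDiff.contDiffAt
  exact ((h2.mul (h3.pow a)).mul (h4.pow b)).mul
    (((contDiffAt_const.mul (h3.mul h4)).mul h1).cexp)

/-- The product rule, arranged so that every coefficient is again a combination of Gaussian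
monomials of the same width. The truncated exponents a - 1 and b - 1 are harmless because of the
factors a and b. -/
theorem hasFDerivAt_gaussFun (hψ : IsBump O ψ) (κ : ℝ) (a b : ℕ) (w : Freq) :
    HasFDerivAt (gaussFun κ ψ a b)
      ((a * gaussFun κ ψ (a - 1) b w -
          κ * gaussFun κ (fun x => ((|x|⁻¹ : ℝ) : ℂ) * ψ x) a (b + 1) w) • coordZ +
        (b * gaussFun κ ψ a (b - 1) w -
          κ * gaussFun κ (fun x => ((|x|⁻¹ : ℝ) : ℂ) * ψ x) (a + 1) b w) • coordZbar +
        (gaussFun κ (deriv ψ) a b w +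
          κ * gaussFun κ (fun x => ((x * |x|⁻¹ ^ 3 : ℝ) : ℂ) * ψ x) (a + 1) (b + 1) w) •
            coordT) w := by
  -- The exponent is singular at τ = 0, but there the function vanishes in a neighbourhood.
  by_cases h0 : freqT w = 0
  · have hz : ψ (freqT w) = 0 := by rw [h0, hψ.apply_zero]
    have hz' : deriv ψ (freqT w) = 0 := by rw [h0, hψ.deriv.apply_zero]
    have hev : gaussFun κ ψ a b =ᶠ[nhds w] fun _ => 0 := by
      have hmem : w ∉ tsupport (gaussFun κ ψ a b) := fun h =>
        (hψ.subset (tsupport_gaussFun_subset κ ψ a b h)).2 h0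
      exact notMem_tsupport_iff_eventuallyEq.1 hmem
    refine HasFDerivAt.congr_of_eventuallyEq ?_ hev
    simp only [gaussFun, hz, hz', zero_mul, mul_zero, sub_self, add_zero]
    refine (hasFDerivAt_const (0 : ℂ) w).congr_fderiv ?_
    ext m
    simp
  · have hT : HasFDerivAt (fun w => freqT w) freqT w := freqT.hasFDerivAt
    have h1 : HasFDerivAt (fun w => ψ (freqT w)) (deriv ψ (freqT w) • coordT) w := by
      have := ((hψ.contDiff.differentiable (by simp)).differentiableAt
        (x := freqT w)).hasDerivAt.hasFDerivAt.comp w hT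
      refine this.congr_fderiv ?_
      ext m
      simp [coordT, mul_comm]
    have h2 : HasFDerivAt (fun w => ((|freqT w|⁻¹ : ℝ) : ℂ))
        (-((freqT w * |freqT w|⁻¹ ^ 3 : ℝ) : ℂ) • coordT) w := by
      have hr : HasDerivAt (fun x : ℝ => |x|⁻¹) (-(freqT w * |freqT w|⁻¹ ^ 3)) (freqT w) := by
        refine ((hasDerivAt_abs h0).inv (abs_ne_zero.2 h0)).congr_deriv ?_
        rcases lt_or_gt_of_ne h0 with h | h
        · rw [sign_neg h, abs_of_neg h]
          simp
          field_simp
        · rw [sign_pos h, abs_of_pos h]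
          simp
          field_simp
      have := hr.ofReal_comp.hasFDerivAt.comp w hT
      refine this.congr_fderiv ?_
      ext m
      simp [coordT, mul_comm]
    have h3 : HasFDerivAt (fun w => coordZ w) coordZ w := coordZ.hasFDerivAt
    have h4 : HasFDerivAt (fun w => coordZbar w) coordZbar w := coordZbar.hasFDerivAt
    have h5 := ((h1.mul (h3.pow a)).mul (h4.pow b)).mul
      ((((hasFDerivAt_const (-(κ : ℂ)) w).mul (h3.mul h4)).mul h2).cexp)
    refine h5.congr_fderiv ?_
    ext m
    simp only [gaussFun]
    simp
    ring

end GaussianMonomials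

/-! ### Gaussian monomials are Schwartz functions. -/

section GaussianSchwartz

open scoped ContDiff

variable {O : Set ℝ} {ψ : ℝ → ℂ}

theorem IsBump.exists_bound (h : IsBump O ψ) :
    ∃ R : ℝ, 0 < R ∧ ∃ M : ℝ, 0 ≤ M ∧ (∀ x, ‖ψ x‖ ≤ M) ∧ ∀ x, ψ x ≠ 0 → |x| ≤ R := by
  obtain ⟨M, hM⟩ := h.compact.exists_bound_of_continuous h.contDiff.continuous
  obtain ⟨R, hR⟩ := h.compact.isBounded.subset_closedBall (0 : ℝ)
  refine ⟨max R 1, by positivity, M, (norm_nonneg _).trans (hM 0), hM, fun x hx => ?_⟩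
  have := hR (subset_tsupport ψ hx)
  rw [Metric.mem_closedBall, dist_zero_right, Real.norm_eq_abs] at this
  exact this.trans (le_max_left _ _)

theorem norm_coordZbar (w : Freq) : ‖coordZbar w‖ = ‖coordZ w‖ := by
  rw [coordZbar_apply, RCLike.norm_conj]

theorem norm_freq_le (w : Freq) : ‖w‖ ≤ ‖coordZ w‖ + |freqT w| := by
  have h : w = WithLp.toLp 2 (coordZ w, 0) + WithLp.toLp 2 (0, freqT w) := by
    rw [← WithLp.toLp_add, Prod.mk_add_mk, add_zero, zero_add]; rfl
  conv_lhs => rw [h]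
  refine (norm_add_le _ _).trans (le_of_eq ?_)
  rw [WithLp.norm_toLp_fst, WithLp.norm_toLp_snd, Real.norm_eq_abs]

theorem norm_gaussFun (κ : ℝ) (a b : ℕ) (w : Freq) :
    ‖gaussFun κ ψ a b w‖ = ‖ψ (freqT w)‖ * ‖coordZ w‖ ^ (a + b) *
      Real.exp (-κ * ‖coordZ w‖ ^ 2 * |freqT w|⁻¹) := by
  have h : -(κ : ℂ) * (coordZ w * coordZbar w) * ((|freqT w|⁻¹ : ℝ) : ℂ) =
      ((-κ * ‖coordZ w‖ ^ 2 * |freqT w|⁻¹ : ℝ) : ℂ) := by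
    rw [coordZbar_apply, Complex.mul_conj, Complex.normSq_eq_norm_sq]
    push_cast
    ring
  rw [gaussFun, h, ← Complex.ofReal_exp, norm_mul, norm_mul, norm_mul, norm_pow, norm_pow,
    norm_coordZbar, Complex.norm_real, Real.norm_eq_abs, Real.abs_exp, pow_add, mul_assoc ‖ψ _‖]

/-- On the support |τ| ≤ R, so with r = |ζ| the Gaussian is at most exp(-κr²/R). Powers of r + R are
bounded by a factorial times exp(r + R), and completing the square, r - κr²/R ≤ R/(4κ), gives the
constant. -/
theorem decay_gaussFun {κ : ℝ} (hκ : 0 < κ) (hψ : IsBump O ψ) (a b k : ℕ) :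
    ∃ C, ∀ w, ‖w‖ ^ k * ‖gaussFun κ ψ a b w‖ ≤ C := by
  obtain ⟨R, hR, M, hM, hb, hs⟩ := hψ.exists_bound
  refine ⟨M * ((k + (a + b)).factorial * Real.exp (R + R / (4 * κ))), fun w => ?_⟩
  by_cases h0 : ψ (freqT w) = 0
  · rw [gaussFun_of_eq_zero κ a b h0, norm_zero, mul_zero]
    positivity
  have ht := hs _ h0
  have ht0 : 0 < |freqT w| := abs_pos.2 fun h => h0 (by rw [h, hψ.apply_zero])
  set r := ‖coordZ w‖ with hr
  have hr0 : 0 ≤ r := norm_nonneg _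
  rw [norm_gaussFun]
  have h1 : ‖w‖ ≤ r + R := (norm_freq_le w).trans (by linarith)
  have h2 : -κ * r ^ 2 * |freqT w|⁻¹ ≤ -κ * r ^ 2 * R⁻¹ := by
    have : R⁻¹ ≤ |freqT w|⁻¹ := inv_anti₀ ht0 ht
    have h3 : 0 ≤ κ * r ^ 2 := by positivity
    nlinarith
  have h4 : (r + R) ^ (k + (a + b)) ≤ (k + (a + b)).factorial * Real.exp (r + R) := by
    have := Real.pow_div_factorial_le_exp (r + R) (by positivity) (k + (a + b))
    rwa [div_le_iff₀ (by positivity), mul_comm] at this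
  have h5 : r + R + -κ * r ^ 2 * R⁻¹ ≤ R + R / (4 * κ) := by
    have : R / (4 * κ) - r + κ * r ^ 2 * R⁻¹ = κ * R⁻¹ * (r - R / (2 * κ)) ^ 2 := by
      field_simp
      ring
    have h6 : 0 ≤ κ * R⁻¹ * (r - R / (2 * κ)) ^ 2 := by positivity
    linarith
  calc ‖w‖ ^ k * (‖ψ (freqT w)‖ * r ^ (a + b) * Real.exp (-κ * r ^ 2 * |freqT w|⁻¹))
      ≤ (r + R) ^ k * (M * (r + R) ^ (a + b) * Real.exp (-κ * r ^ 2 * R⁻¹)) := by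
        gcongr
        · exact hb _
        · linarith
    _ = M * ((r + R) ^ (k + (a + b)) * Real.exp (-κ * r ^ 2 * R⁻¹)) := by ring
    _ ≤ M * ((k + (a + b)).factorial * Real.exp (r + R) * Real.exp (-κ * r ^ 2 * R⁻¹)) := by
        gcongr
    _ = M * ((k + (a + b)).factorial * Real.exp (r + R + -κ * r ^ 2 * R⁻¹)) := by
        rw [Real.exp_add (r + R)]; ring
    _ ≤ _ := by gcongr

/-- The span of the Gaussian monomials of a fixed width. -/
def gaussSpan (κ : ℝ) (O : Set ℝ) : Submodule ℂ (Freq → ℂ) :=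
  Submodule.span ℂ {f | ∃ ψ a b, IsBump O ψ ∧ f = gaussFun κ ψ a b}

theorem gaussFun_mem_gaussSpan (κ : ℝ) (hψ : IsBump O ψ) (a b : ℕ) :
    gaussFun κ ψ a b ∈ gaussSpan κ O :=
  Submodule.subset_span ⟨ψ, a, b, hψ, rfl⟩

theorem contDiff_of_mem_gaussSpan {κ : ℝ} {f : Freq → ℂ} (hf : f ∈ gaussSpan κ O) :
    ContDiff ℝ ∞ f := by
  induction hf using Submodule.span_induction with
  | mem f hf => obtain ⟨ψ, a, b, hψ, rfl⟩ := hf; exact contDiff_gaussFun hψ κ a b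
  | zero => exact contDiff_const
  | add f g _ _ hf hg => exact hf.add hg
  | smul c f _ hf => exact contDiff_const.smul hf

theorem decay_of_mem_gaussSpan {κ : ℝ} (hκ : 0 < κ) {f : Freq → ℂ} (hf : f ∈ gaussSpan κ O)
    (k : ℕ) : ∃ C, ∀ w, ‖w‖ ^ k * ‖f w‖ ≤ C := by
  induction hf using Submodule.span_induction with
  | mem f hf => obtain ⟨ψ, a, b, hψ, rfl⟩ := hf; exact decay_gaussFun hκ hψ a b k
  | zero => exact ⟨0, fun w => by simp⟩
  | add f g _ _ hf hg =>
    obtain ⟨C, hC⟩ := hf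
    obtain ⟨D, hD⟩ := hg
    refine ⟨C + D, fun w => ?_⟩
    have : ‖w‖ ^ k * ‖(f + g) w‖ ≤ ‖w‖ ^ k * (‖f w‖ + ‖g w‖) := by
      gcongr
      exact norm_add_le _ _
    linarith [hC w, hD w]
  | smul c f _ hf =>
    obtain ⟨C, hC⟩ := hf
    refine ⟨‖c‖ * C, fun w => ?_⟩
    rw [Pi.smul_apply, norm_smul, mul_left_comm]
    gcongr
    exact hC w

theorem fderiv_mem_gaussSpan {κ : ℝ} {f : Freq → ℂ} (hf : f ∈ gaussSpan κ O) (m : Freq) :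
    (fun w => fderiv ℝ f w m) ∈ gaussSpan κ O := by
  induction hf using Submodule.span_induction with
  | mem f hf =>
    obtain ⟨ψ, a, b, hψ, rfl⟩ := hf
    have h := fun ψ (hψ : IsBump O ψ) a b => gaussFun_mem_gaussSpan κ hψ a b
    have h1 := ((gaussSpan κ O).sub_mem
        ((gaussSpan κ O).smul_mem (a : ℂ) (h _ hψ (a - 1) b))
        ((gaussSpan κ O).smul_mem (κ : ℂ) (h _ hψ.mul_abs_inv a (b + 1))))
    have h2 := ((gaussSpan κ O).sub_mem
        ((gaussSpan κ O).smul_mem (b : ℂ) (h _ hψ a (b - 1)))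
        ((gaussSpan κ O).smul_mem (κ : ℂ) (h _ hψ.mul_abs_inv (a + 1) b)))
    have h3 := ((gaussSpan κ O).add_mem (h _ hψ.deriv a b)
        ((gaussSpan κ O).smul_mem (κ : ℂ) (h _ hψ.mul_abs_inv_cube (a + 1) (b + 1))))
    have h4 := (gaussSpan κ O).add_mem ((gaussSpan κ O).add_mem
      ((gaussSpan κ O).smul_mem (coordZ m) h1) ((gaussSpan κ O).smul_mem (coordZbar m) h2))
      ((gaussSpan κ O).smul_mem (coordT m) h3)
    convert h4 using 1
    ext w
    rw [(hasFDerivAt_gaussFun hψ κ a b w).fderiv]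
    simp only [add_apply, smul_apply, Pi.add_apply, Pi.smul_apply, Pi.sub_apply, smul_eq_mul]
    ring
  | zero =>
    convert (gaussSpan κ O).zero_mem using 1
    ext w
    simp
  | add f g hf hg h1 h2 =>
    convert (gaussSpan κ O).add_mem h1 h2 using 1
    ext w
    rw [fderiv_add ((contDiff_of_mem_gaussSpan hf).differentiable (by simp) w)
      ((contDiff_of_mem_gaussSpan hg).differentiable (by simp) w)]
    rfl
  | smul c f hf h =>
    convert (gaussSpan κ O).smul_mem c h using 1
    ext w
    rw [fderiv_const_smul ((contDiff_of_mem_gaussSpan hf).differentiable (by simp) w)]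
    rfl

/-- The Gaussian monomials as Schwartz functions. -/
def gaussSchwartz {κ : ℝ} (hκ : 0 < κ) (hψ : IsBump O ψ) (a b : ℕ) : 𝓢(Freq, ℂ) where
  toFun := gaussFun κ ψ a b
  smooth' := contDiff_gaussFun hψ κ a b
  decay' k n := decay_iteratedFDeriv_of_stable (gaussSpan κ O)
    (fun _ => contDiff_of_mem_gaussSpan) (fun _ hf => decay_of_mem_gaussSpan hκ hf)
    (fun _ => fderiv_mem_gaussSpan) k n _ (gaussFun_mem_gaussSpan κ hψ a b)

theorem gaussSchwartz_apply {κ : ℝ} (hκ : 0 < κ) (hψ : IsBump O ψ) (a b : ℕ) (w : Freq) :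
    gaussSchwartz hκ hψ a b w = gaussFun κ ψ a b w := rfl

end GaussianSchwartz

/-! ### Ladder operators on Gaussian monomials. -/

section LadderOperators

open scoped Real

variable {O : Set ℝ} {ψ : ℝ → ℂ}

/-- Derivatives along ζ do not see τ, which acts as a parameter. -/
theorem lineDerivOp_mulForm_freqT (m : Freq) (hm : freqT m = 0) (v : 𝓢(Freq, ℂ)) (w : Freq) :
    (∂_{m} (mulForm freqT v)) w = freqT w * fderiv ℝ v w m := by
  rw [SchwartzMap.lineDerivOp_apply_eq_fderiv]
  have h1 : HasFDerivAt (fun w : Freq => (freqT w : ℂ)) coordT w := coordT.hasFDerivAt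
  have h2 := h1.mul (v.hasFDerivAt w)
  have h3 : ⇑(mulForm freqT v) = (fun w : Freq => (freqT w : ℂ)) * ⇑v := by
    ext w; exact mulForm_apply _ _ _
  rw [h3, h2.fderiv]
  simp [coordT, hm]

theorem freqX_apply (v : 𝓢(Freq, ℂ)) (w : Freq) :
    freqX v w = 2 * π * Complex.I * (freqRe w * v w) +
      2 * (freqT w * fderiv ℝ v w (freqEquiv.symm ((Complex.I, 0) : H3))) := by
  rw [freqX, add_apply, smul_apply, smul_apply, mulForm_apply,
    lineDerivOp_mulForm_freqT _ (by simp [freqT])]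
  rfl

theorem freqY_apply (v : 𝓢(Freq, ℂ)) (w : Freq) :
    freqY v w = 2 * π * Complex.I * (freqIm w * v w) -
      2 * (freqT w * fderiv ℝ v w (freqEquiv.symm ((1, 0) : H3))) := by
  rw [freqY, sub_apply, smul_apply, smul_apply, mulForm_apply,
    lineDerivOp_mulForm_freqT _ (by simp [freqT])]
  rfl

theorem fderiv_add_smul_apply (c d : ℂ) (u v : 𝓢(Freq, ℂ)) (w m : Freq) :
    fderiv ℝ (c • u + d • v : 𝓢(Freq, ℂ)) w m = c * fderiv ℝ u w m + d * fderiv ℝ v w m := by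
  have h : ⇑(c • u + d • v : 𝓢(Freq, ℂ)) = c • ⇑u + d • ⇑v := rfl
  rw [h, (((u.hasFDerivAt w).const_smul c).add ((v.hasFDerivAt w).const_smul d)).fderiv]
  rfl

theorem freqX_add_smul (c d : ℂ) (u v : 𝓢(Freq, ℂ)) :
    freqX (c • u + d • v) = c • freqX u + d • freqX v := by
  ext w
  simp only [freqX_apply, fderiv_add_smul_apply, add_apply, smul_apply, smul_eq_mul]
  ring

theorem freqY_add_smul (c d : ℂ) (u v : 𝓢(Freq, ℂ)) :
    freqY (c • u + d • v) = c • freqY u + d • freqY v := by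
  ext w
  simp only [freqY_apply, fderiv_add_smul_apply, add_apply, smul_apply, smul_eq_mul]
  ring

/-- The combination `X - iY` on the frequency side. -/
def lower (v : 𝓢(Freq, ℂ)) : 𝓢(Freq, ℂ) := (1 : ℂ) • freqX v + (-Complex.I) • freqY v

/-- The combination `X + iY` on the frequency side. -/
def raise (v : 𝓢(Freq, ℂ)) : 𝓢(Freq, ℂ) := (1 : ℂ) • freqX v + Complex.I • freqY v

theorem lower_add_smul (c d : ℂ) (u v : 𝓢(Freq, ℂ)) :
    lower (c • u + d • v) = c • lower u + d • lower v := by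
  simp only [lower, freqX_add_smul, freqY_add_smul]
  module

theorem raise_add_smul (c d : ℂ) (u v : 𝓢(Freq, ℂ)) :
    raise (c • u + d • v) = c • raise u + d • raise v := by
  simp only [raise, freqX_add_smul, freqY_add_smul]
  module

/-- In the symmetrised product of X - iY and X + iY the mixed terms cancel, so no commutator has to
be computed. -/
theorem freqSubLaplacian_eq (v : 𝓢(Freq, ℂ)) :
    freqSubLaplacian v = (-(1 / 2) : ℂ) • (lower (raise v) + raise (lower v)) := by
  rw [freqSubLaplacian, lower, raise, raise, lower, freqX_add_smul, freqX_add_smul,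
    freqY_add_smul, freqY_add_smul]
  ext w
  simp only [neg_apply, add_apply, smul_apply, smul_eq_mul]
  linear_combination (-(freqY (freqY v) w)) * Complex.I_sq

theorem coordZ_freqRe_freqIm (w : Freq) :
    coordZ w = freqRe w + freqIm w * Complex.I ∧ coordZbar w = freqRe w - freqIm w * Complex.I := by
  have h : coordZ w = freqRe w + freqIm w * Complex.I := (Complex.re_add_im (coordZ w)).symm
  refine ⟨h, ?_⟩
  rw [coordZbar_apply, h]
  simp [sub_eq_add_neg]

/-- The width π/2 is the one for which differentiating the Gaussian cancels the multiplication term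
of `lower` when τ > 0 and that of `raise` when τ < 0. -/
theorem half_pi_pos : 0 < π / 2 := Real.pi_div_two_pos

/-- In complex coordinates `lower` is 2πi conj ζ + 4iτ ∂_ζ, and the Gaussian contributes -2πi sgn(τ)
conj ζ. -/
theorem lower_gaussSchwartz (hψ : IsBump O ψ) (a b : ℕ) :
    lower (gaussSchwartz half_pi_pos hψ a b) =
      (2 * π * Complex.I) • gaussSchwartz half_pi_pos (hψ.mul_one_add_sign (-1)) a (b + 1) +
      (4 * Complex.I * a) • gaussSchwartz half_pi_pos hψ.mul_id (a - 1) b := by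
  ext w
  have hf : ⇑(gaussSchwartz half_pi_pos hψ a b) = gaussFun (π / 2) ψ a b := rfl
  obtain ⟨hz, hzb⟩ := coordZ_freqRe_freqIm w
  have c1 : coordZ (freqEquiv.symm ((Complex.I, 0) : H3)) = Complex.I := rfl
  have c2 : coordZbar (freqEquiv.symm ((Complex.I, 0) : H3)) = -Complex.I := Complex.conj_I
  have c3 : coordT (freqEquiv.symm ((Complex.I, 0) : H3)) = 0 := rfl
  have c4 : coordZ (freqEquiv.symm ((1, 0) : H3)) = 1 := rfl
  have c5 : coordZbar (freqEquiv.symm ((1, 0) : H3)) = 1 := map_one (starRingEnd ℂ)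
  have c6 : coordT (freqEquiv.symm ((1, 0) : H3)) = 0 := rfl
  simp only [lower, add_apply, smul_apply, smul_eq_mul, freqX_apply, freqY_apply, hf,
    (hasFDerivAt_gaussFun hψ _ a b w).fderiv, gaussSchwartz_apply, gaussFun_mul,
    gaussFun_succ_left, gaussFun_succ_right, c1, c2, c3, c4, c5, c6]
  rw [hz, hzb]
  push_cast
  ring

/-- Here `raise` is 2πi ζ - 4iτ ∂_{conj ζ}, and the Gaussian contributes +2πi sgn(τ) ζ. -/
theorem raise_gaussSchwartz (hψ : IsBump O ψ) (a b : ℕ) :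
    raise (gaussSchwartz half_pi_pos hψ a b) =
      (2 * π * Complex.I) • gaussSchwartz half_pi_pos (hψ.mul_one_add_sign 1) (a + 1) b +
      (-4 * Complex.I * b) • gaussSchwartz half_pi_pos hψ.mul_id a (b - 1) := by
  ext w
  have hf : ⇑(gaussSchwartz half_pi_pos hψ a b) = gaussFun (π / 2) ψ a b := rfl
  obtain ⟨hz, hzb⟩ := coordZ_freqRe_freqIm w
  have c1 : coordZ (freqEquiv.symm ((Complex.I, 0) : H3)) = Complex.I := rfl
  have c2 : coordZbar (freqEquiv.symm ((Complex.I, 0) : H3)) = -Complex.I := Complex.conj_I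
  have c3 : coordT (freqEquiv.symm ((Complex.I, 0) : H3)) = 0 := rfl
  have c4 : coordZ (freqEquiv.symm ((1, 0) : H3)) = 1 := rfl
  have c5 : coordZbar (freqEquiv.symm ((1, 0) : H3)) = 1 := map_one (starRingEnd ℂ)
  have c6 : coordT (freqEquiv.symm ((1, 0) : H3)) = 0 := rfl
  simp only [raise, add_apply, smul_apply, smul_eq_mul, freqX_apply, freqY_apply, hf,
    (hasFDerivAt_gaussFun hψ _ a b w).fderiv, gaussSchwartz_apply, gaussFun_mul,
    gaussFun_succ_left, gaussFun_succ_right, c1, c2, c3, c4, c5, c6]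
  rw [hz, hzb]
  push_cast
  ring

end LadderOperators

/-! ### Landau levels, back substitution and approximate eigenfunctions. -/

section Eigenvalues

open scoped Real ContDiff

variable {O : Set ℝ} {ψ : ℝ → ℂ}

/-- The diagonal coefficient of the sub-Laplacian on Gaussian monomials. -/
def landauLevel (a b : ℕ) (x : ℝ) : ℝ :=
  4 * π * ((2 * a + 1) * (|x| + x) + (2 * b + 1) * (|x| - x))

theorem IsBump.mul_landauLevel (h : IsBump O ψ) (a b : ℕ) (lam : ℂ) :
    IsBump O (fun x => ((landauLevel a b x : ℂ) - lam) * ψ x) :=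
  h.mul fun _ _ hx => (contDiffAt_ofReal (contDiffAt_const.mul
    ((contDiffAt_const.mul ((contDiffAt_abs hx).add contDiffAt_id)).add
      (contDiffAt_const.mul ((contDiffAt_abs hx).sub contDiffAt_id))))).sub contDiffAt_const

/-- The term raising both exponents carries (1 - sgn τ)(1 + sgn τ) = 0, so the operator is
triangular: only a diagonal term and one of lower degree survive. -/
theorem freqSubLaplacian_gaussSchwartz (hψ : IsBump O ψ) (a b : ℕ) (lam : ℂ) :
    freqSubLaplacian (gaussSchwartz half_pi_pos hψ a b) -
        lam • gaussSchwartz half_pi_pos hψ a b =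
      gaussSchwartz half_pi_pos (hψ.mul_landauLevel a b lam) a b -
      (16 * a * b : ℂ) • gaussSchwartz half_pi_pos hψ.mul_id.mul_id (a - 1) (b - 1) := by
  rw [freqSubLaplacian_eq, lower_gaussSchwartz, raise_gaussSchwartz, lower_add_smul,
    raise_add_smul]
  simp only [lower_gaussSchwartz, raise_gaussSchwartz]
  ext w
  simp only [add_apply, sub_apply, smul_apply, smul_eq_mul, gaussSchwartz_apply, gaussFun_mul]
  by_cases h0 : freqT w = 0
  · have hz : ψ (freqT w) = 0 := by rw [h0, hψ.apply_zero]
    simp only [gaussFun_of_eq_zero _ _ _ hz, mul_zero, add_zero, sub_zero]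
  · have hs : (freqT w * |freqT w|⁻¹ = 1 ∧ |freqT w| = freqT w) ∨
        (freqT w * |freqT w|⁻¹ = -1 ∧ |freqT w| = -freqT w) := by
      rcases lt_or_gt_of_ne h0 with h | h
      · right; rw [abs_of_neg h]; exact ⟨by field_simp, rfl⟩
      · left; rw [abs_of_pos h]; exact ⟨by field_simp, rfl⟩
    have hI : Complex.I ^ 2 = -1 := Complex.I_sq
    rcases hs with ⟨h1, h2⟩ | ⟨h1, h2⟩ <;>
    · rw [landauLevel, h1, h2]
      rcases a with _ | a <;> rcases b with _ | b <;>
      · simp only [Nat.add_sub_cancel, Nat.cast_zero, mul_zero, zero_mul, Nat.cast_add,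
          Nat.cast_one]
        push_cast
        ring_nf
        simp only [hI]
        ring

/-- The frequencies at which `lam` is not a Landau level. -/
def regularFreq (lam : ℂ) : Set ℝ := {x | ∀ n : ℕ, ((8 * π * (2 * n + 1) * |x| : ℝ) : ℂ) ≠ lam}

/-- The level equals 8π(2a+1)|x| for x ≥ 0 and 8π(2b+1)|x| for x < 0. -/
theorem landauLevel_sub_ne_zero {lam : ℂ} {x : ℝ} (hx : x ∈ regularFreq lam) (a b : ℕ) :
    (landauLevel a b x : ℂ) - lam ≠ 0 := by
  rw [sub_ne_zero, landauLevel]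
  rcases abs_cases x with ⟨h, -⟩ | ⟨h, -⟩
  · convert hx a using 2
    rw [h]; ring
  · convert hx b using 2
    rw [h]; ring

theorem IsBump.mul_resolvent {lam : ℂ} (h : IsBump (regularFreq lam) ψ) (a b : ℕ) :
    IsBump (regularFreq lam) (fun x => ((landauLevel a b x : ℂ) - lam)⁻¹ * ψ x) :=
  h.mul fun _ hxO hx => ((contDiffAt_ofReal (contDiffAt_const.mul
    ((contDiffAt_const.mul ((contDiffAt_abs hx).add contDiffAt_id)).add
      (contDiffAt_const.mul ((contDiffAt_abs hx).sub contDiffAt_id))))).sub contDiffAt_const).inv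
      (landauLevel_sub_ne_zero hxO a b)

theorem freqSubLaplacian_sub_add_smul (lam c d : ℂ) (u v : 𝓢(Freq, ℂ)) :
    freqSubLaplacian (c • u + d • v) - lam • (c • u + d • v) =
      c • (freqSubLaplacian u - lam • u) + d • (freqSubLaplacian v - lam • v) := by
  simp only [freqSubLaplacian_eq, lower_add_smul, raise_add_smul]
  module

/-- Back substitution: dividing the bump by level minus λ solves the equation up to a monomial with
a lowered by one, to which induction applies. The remainder has the factor ab, so it vanishes at a =
0, and also at b = 0, where b - 1 is truncated. -/
theorem exists_freqSubLaplacian_sub_eq {lam : ℂ} (a : ℕ) :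
    ∀ (b : ℕ) (ψ : ℝ → ℂ) (hψ : IsBump (regularFreq lam) ψ),
      ∃ v : 𝓢(Freq, ℂ), freqSubLaplacian v - lam • v = gaussSchwartz half_pi_pos hψ a b := by
  have key : ∀ (a b : ℕ) (ψ : ℝ → ℂ) (hψ : IsBump (regularFreq lam) ψ),
      gaussSchwartz half_pi_pos ((hψ.mul_resolvent a b).mul_landauLevel a b lam) a b =
        gaussSchwartz half_pi_pos hψ a b := by
    intro a b ψ hψ
    ext w
    rw [gaussSchwartz_apply, gaussSchwartz_apply, gaussFun_mul, gaussFun_mul]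
    by_cases h : ψ (freqT w) = 0
    · rw [gaussFun_of_eq_zero _ _ _ h, mul_zero, mul_zero]
    · have := landauLevel_sub_ne_zero (hψ.subset (subset_tsupport ψ h)).1 a b
      rw [mul_inv_cancel_left₀ this]
  induction a with
  | zero =>
    intro b ψ hψ
    refine ⟨gaussSchwartz half_pi_pos (hψ.mul_resolvent 0 b) 0 b, ?_⟩
    rw [freqSubLaplacian_gaussSchwartz, key _ _ _ hψ]
    simp
  | succ a ih =>
    intro b ψ hψ
    obtain ⟨v, hv⟩ := ih (b - 1) _ (hψ.mul_resolvent (a + 1) b).mul_id.mul_id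
    refine ⟨(1 : ℂ) • gaussSchwartz half_pi_pos (hψ.mul_resolvent (a + 1) b) (a + 1) b +
      (16 * (a + 1 : ℕ) * b : ℂ) • v, ?_⟩
    rw [freqSubLaplacian_sub_add_smul, hv, freqSubLaplacian_gaussSchwartz, key _ _ _ hψ]
    simp

/-- Near x ≠ 0 one has |y| > |x|/2, so the levels with n ≥ N > ‖λ‖/|x| exceed ‖λ‖ and only finitely
many conditions remain. At 0 this uniformity fails. -/
theorem isOpen_regularFreq (lam : ℂ) : IsOpen (regularFreq lam \ {0}) := by
  rw [isOpen_iff_mem_nhds]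
  rintro x ⟨hx, hx0⟩
  have hx0 : 0 < |x| := abs_pos.2 hx0
  obtain ⟨N, hN⟩ := exists_nat_gt (‖lam‖ / |x|)
  rw [div_lt_iff₀ hx0] at hN
  have h1 : ∀ᶠ y in nhds x, |x| / 2 < |y| :=
    (continuous_abs.tendsto x).eventually (lt_mem_nhds (by linarith))
  have h2 : ∀ᶠ y in nhds x, ∀ n ∈ Finset.range N, ((8 * π * (2 * n + 1) * |y| : ℝ) : ℂ) ≠ lam := by
    rw [Filter.eventually_all_finset]
    intro n _
    have hc : Continuous fun y : ℝ => ((8 * π * (2 * n + 1) * |y| : ℝ) : ℂ) := by fun_prop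
    exact hc.continuousAt.eventually_ne (hx n)
  filter_upwards [h1, h2] with y hy1 hy2
  have hy0 : 0 < |y| := by linarith
  refine ⟨fun n h => ?_, fun h => by rw [h, abs_zero] at hy0; exact hy0.false⟩
  by_cases hn : n < N
  · exact hy2 n (Finset.mem_range.2 hn) h
  · have hnN : (N : ℝ) ≤ n := by exact_mod_cast not_lt.1 hn
    have h3 : ‖lam‖ = 8 * π * (2 * n + 1) * |y| := by
      rw [← h, Complex.norm_real, Real.norm_eq_abs, abs_of_nonneg (by positivity)]
    have h4 : (1 : ℝ) ≤ π := by linarith [Real.pi_gt_three]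
    have h5 : (N : ℝ) * |x| ≤ n * |x| := by gcongr
    have h6 : (n : ℝ) * |x| ≤ n * (2 * |y|) := by gcongr; linarith
    have h7 : 1 * (n * (2 * |y|)) ≤ π * (8 * (2 * n + 1) * |y|) := by
      refine mul_le_mul h4 ?_ (by positivity) (by positivity)
      have : 0 ≤ (n : ℝ) * |y| := by positivity
      nlinarith
    linarith

theorem countable_compl_regularFreq (lam : ℂ) : (regularFreq lam \ {0})ᶜ.Countable := by
  have h : (regularFreq lam \ {0})ᶜ ⊆ {0} ∪ ⋃ n : ℕ,
      {lam.re / (8 * π * (2 * n + 1)), -(lam.re / (8 * π * (2 * n + 1)))} := by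
    intro x hx
    by_cases h0 : x = 0
    · exact Or.inl h0
    right
    have : x ∉ regularFreq lam := fun h => hx ⟨h, h0⟩
    simp only [regularFreq, Set.mem_ofPred_eq, not_forall, not_not] at this
    obtain ⟨n, hn⟩ := this
    refine Set.mem_iUnion.2 ⟨n, ?_⟩
    have h1 : |x| = lam.re / (8 * π * (2 * n + 1)) := by
      rw [← hn, Complex.ofReal_re]
      field_simp
    rw [← h1]
    rcases abs_cases x with ⟨h, -⟩ | ⟨h, -⟩
    · left; exact h.symm
    · right; rw [h, neg_neg]; rfl
  exact ((Set.countable_singleton 0).union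
    (Set.countable_iUnion fun n => (Set.toFinite _).countable)).mono h

theorem exists_isBump_of_isOpen {U : Set ℝ} (hU : IsOpen U) (hU0 : (0 : ℝ) ∉ U) {x : ℝ}
    (hx : x ∈ U) : ∃ ψ, IsBump U ψ ∧ ψ x = 1 := by
  obtain ⟨f, h1, h2, h3, -, h4⟩ := exists_contDiff_tsupport_subset (n := ⊤) (hU.mem_nhds hx)
  have hs : tsupport (fun x => (f x : ℂ)) ⊆ tsupport f :=
    closure_mono fun y hy h => hy (by simp [h])
  refine ⟨fun x => (f x : ℂ), ⟨Complex.ofRealCLM.contDiff.comp h3,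
    h2.comp_left Complex.ofReal_zero, fun y hy => ?_⟩, by simp [h4]⟩
  exact ⟨h1 (hs hy), fun h0 => hU0 (h0 ▸ h1 (hs hy))⟩

/-- Approximate eigenfunctions on the frequency side. -/
theorem exists_approx_eigenfunction {r : ℝ} (hr : 0 ≤ r) {ε : ℝ} (hε : 0 < ε) :
    ∃ v : 𝓢(Freq, ℂ), v ≠ 0 ∧
      ∀ w, ‖(freqSubLaplacian v - (r : ℂ) • v) w‖ ≤ ε * ‖v w‖ := by
  have hπ := Real.pi_pos
  -- For a = b = 0 there is no lower term, so on this set of τ the shifted operator multiplies by a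
  -- number smaller than ε.
  let U : Set ℝ := {x | 0 < x ∧ |8 * π * x - r| < ε}
  have hU : IsOpen U := (isOpen_lt continuous_const continuous_id).inter
    (isOpen_lt (f := fun x : ℝ => |8 * π * x - r|) (by fun_prop) continuous_const)
  -- The offset keeps the point positive even for r = 0, and its level misses r by ε/2.
  have hx : r / (8 * π) + ε / (16 * π) ∈ U := by
    refine ⟨by positivity, ?_⟩
    have : 8 * π * (r / (8 * π) + ε / (16 * π)) - r = ε / 2 := by field_simp; ring
    rw [this, abs_of_pos (by positivity)]
    linarith
  obtain ⟨ψ, hψ, h1⟩ := exists_isBump_of_isOpen hU (fun h => lt_irrefl _ h.1) hx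
  refine ⟨gaussSchwartz half_pi_pos hψ 0 0, fun h => ?_, fun w => ?_⟩
  · have h2 : gaussFun (π / 2) ψ 0 0
        (freqEquiv.symm ((0, r / (8 * π) + ε / (16 * π)) : H3)) = 0 := DFunLike.congr_fun h _
    have h3 : freqT (freqEquiv.symm ((0, r / (8 * π) + ε / (16 * π)) : H3)) =
      r / (8 * π) + ε / (16 * π) := rfl
    have h4 : coordZ (freqEquiv.symm ((0, r / (8 * π) + ε / (16 * π)) : H3)) = 0 := rfl
    rw [gaussFun, h3, h4, h1] at h2
    simp at h2
  · rw [freqSubLaplacian_gaussSchwartz]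
    simp only [sub_apply, smul_apply, smul_eq_mul, gaussSchwartz_apply, gaussFun_mul,
      Nat.cast_zero, mul_zero, zero_mul, sub_zero, norm_mul]
    by_cases h0 : ψ (freqT w) = 0
    · rw [gaussFun_of_eq_zero _ _ _ h0, norm_zero, mul_zero, mul_zero]
    · obtain ⟨hp, hlt⟩ := (hψ.subset (subset_tsupport ψ h0)).1
      gcongr
      rw [← Complex.ofReal_sub, Complex.norm_real, Real.norm_eq_abs]
      convert hlt.le using 2
      rw [landauLevel, abs_of_pos hp]
      push_cast
      ring

end Eigenvalues

/-! ### Totality of the Gaussian monomials in L². -/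

section Totality

open scoped Real ContDiff FourierTransform

/-- An integrable function whose Fourier transform vanishes is zero almost everywhere. -/
theorem ae_eq_zero_of_fourier_eq_zero {V : Type*} [NormedAddCommGroup V] [InnerProductSpace ℝ V]
    [FiniteDimensional ℝ V] [MeasurableSpace V] [BorelSpace V] {G : V → ℂ} (hG : Integrable G)
    (h : ∀ y, 𝓕 G y = 0) : ∀ᵐ x, G x = 0 := by
  refine ae_eq_zero_of_integral_contDiff_smul_eq_zero hG.locallyIntegrable fun g hg hc => ?_
  have hc' : HasCompactSupport (fun x => (g x : ℂ)) := hc.comp_left Complex.ofReal_zero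
  let φ : 𝓢(V, ℂ) := hc'.toSchwartzMap (Complex.ofRealCLM.contDiff.comp hg)
  have hφ : (𝓕 (𝓕⁻ φ : 𝓢(V, ℂ)) : 𝓢(V, ℂ)) = φ := FourierTransform.fourier_fourierInv_eq φ
  -- Writing the test function as a Fourier transform lets the multiplication formula move the
  -- transform onto G.
  have h1 : ∀ x, g x • G x = 𝓕 (⇑(𝓕⁻ φ : 𝓢(V, ℂ))) x • G x := by
    intro x
    rw [← SchwartzMap.fourier_coe, hφ, Complex.real_smul, smul_eq_mul]
    rfl
  simp_rw [h1]
  have h2 := VectorFourier.integral_fourierIntegral_smul_eq_flip (μ := (volume : Measure V))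
    (ν := (volume : Measure V)) (L := innerₗ V) Real.continuous_fourierChar
    continuous_inner (𝓕⁻ φ : 𝓢(V, ℂ)).integrable hG
  rw [flip_innerₗ] at h2
  refine h2.trans ?_
  rw [← integral_zero V ℂ]
  congr 1
  ext x
  rw [show VectorFourier.fourierIntegral Real.fourierChar volume (innerₗ V) G x = 𝓕 G x from rfl,
    h, smul_zero]

variable {O : Set ℝ} {ψ : ℝ → ℂ} {F : Freq → ℂ}

theorem memLp_gaussFun {κ : ℝ} (hκ : 0 < κ) (hψ : IsBump O ψ) (a b : ℕ) :
    MemLp (gaussFun κ ψ a b) 2 volume :=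
  (gaussSchwartz hκ hψ a b).memLp 2 volume

theorem integrable_mul_gaussFun (hF : MemLp F 2 volume) {κ : ℝ} (hκ : 0 < κ) (hψ : IsBump O ψ)
    (a b : ℕ) : Integrable (fun w => F w * gaussFun κ ψ a b w) :=
  hF.integrable_mul (memLp_gaussFun hκ hψ a b)

theorem gaussFun_eq_monomial_mul (κ : ℝ) (a b : ℕ) (w : Freq) :
    gaussFun κ ψ a b w = coordZ w ^ a * coordZbar w ^ b * gaussFun κ ψ 0 0 w := by
  simp only [gaussFun]; ring

theorem integral_linear_pow_mul_gaussFun (hF : MemLp F 2 volume) {κ : ℝ} (hκ : 0 < κ)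
    (hψ : IsBump O ψ) (h : ∀ a b, ∫ w, F w * gaussFun κ ψ a b w = 0) (c d : ℂ) (n : ℕ) :
    ∫ w, F w * ((c * coordZ w + d * coordZbar w) ^ n * gaussFun κ ψ 0 0 w) = 0 := by
  have h1 : ∀ w, F w * ((c * coordZ w + d * coordZbar w) ^ n * gaussFun κ ψ 0 0 w) =
      ∑ k ∈ Finset.range (n + 1), (c ^ k * d ^ (n - k) * n.choose k) *
        (F w * gaussFun κ ψ k (n - k) w) := by
    intro w
    rw [add_pow, Finset.sum_mul, Finset.mul_sum]
    refine Finset.sum_congr rfl fun k _ => ?_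
    rw [gaussFun_eq_monomial_mul κ k (n - k)]
    ring
  simp_rw [h1]
  rw [integral_finsetSum]
  · refine Finset.sum_eq_zero fun k _ => ?_
    rw [integral_const_mul, h, mul_zero]
  · exact fun k _ => (integrable_mul_gaussFun hF hκ hψ k (n - k)).const_mul _

/-- Half of the Gaussian absorbs the exponential, since sr - κr²/(2R) ≤ s²R/(2κ). The other half
stays in L² and makes the dominating function below integrable. -/
theorem exists_exp_mul_norm_gaussFun_le {κ : ℝ} (hκ : 0 < κ) (hψ : IsBump O ψ) (s : ℝ) :
    ∃ C : ℝ, ∀ w, Real.exp (s * ‖coordZ w‖) * ‖gaussFun κ ψ 0 0 w‖ ≤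
      C * ‖gaussFun (κ / 2) ψ 0 0 w‖ := by
  obtain ⟨R, hR, M, hM, hb, hs⟩ := hψ.exists_bound
  refine ⟨Real.exp (s ^ 2 * R / (2 * κ)), fun w => ?_⟩
  by_cases h0 : ψ (freqT w) = 0
  · simp [gaussFun_of_eq_zero _ _ _ h0]
  have ht := hs _ h0
  have ht0 : 0 < |freqT w| := abs_pos.2 fun h => h0 (by rw [h, hψ.apply_zero])
  rw [norm_gaussFun, norm_gaussFun]
  set r := ‖coordZ w‖ with hr
  have h1 : s * r + -κ * r ^ 2 * |freqT w|⁻¹ ≤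
      s ^ 2 * R / (2 * κ) + -(κ / 2) * r ^ 2 * |freqT w|⁻¹ := by
    have h2 : R⁻¹ ≤ |freqT w|⁻¹ := inv_anti₀ ht0 ht
    have h3 : 0 ≤ κ / 2 * r ^ 2 := by positivity
    have h4 : s ^ 2 * R / (2 * κ) - s * r + κ / 2 * r ^ 2 * R⁻¹ =
        κ / 2 * R⁻¹ * (r - s * R / κ) ^ 2 := by
      field_simp
      ring
    have h5 : 0 ≤ κ / 2 * R⁻¹ * (r - s * R / κ) ^ 2 := by positivity
    nlinarith
  have h6 := Real.exp_le_exp.2 h1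
  rw [Real.exp_add, Real.exp_add] at h6
  have h7 : 0 ≤ ‖ψ (freqT w)‖ * r ^ (0 + 0) := by positivity
  calc Real.exp (s * r) * (‖ψ (freqT w)‖ * r ^ (0 + 0) * Real.exp (-κ * r ^ 2 * |freqT w|⁻¹))
      = (‖ψ (freqT w)‖ * r ^ (0 + 0)) *
          (Real.exp (s * r) * Real.exp (-κ * r ^ 2 * |freqT w|⁻¹)) := by ring
    _ ≤ (‖ψ (freqT w)‖ * r ^ (0 + 0)) * (Real.exp (s ^ 2 * R / (2 * κ)) *
          Real.exp (-(κ / 2) * r ^ 2 * |freqT w|⁻¹)) := by gcongr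
    _ = _ := by ring

/-- The exponential series is integrated term by term; each term is a combination of vanishing
moments, and exp(s|ζ|) dominates the series. -/
theorem integral_exp_mul_gaussFun (hF : MemLp F 2 volume) {κ : ℝ} (hκ : 0 < κ)
    (hψ : IsBump O ψ) (h : ∀ a b, ∫ w, F w * gaussFun κ ψ a b w = 0) (c d : ℂ) :
    ∫ w, F w * (Complex.exp (c * coordZ w + d * coordZbar w) * gaussFun κ ψ 0 0 w) = 0 := by
  set s := ‖c‖ + ‖d‖ with hs
  obtain ⟨C, hC⟩ := exists_exp_mul_norm_gaussFun_le hκ hψ s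
  have hexp : ∀ x : ℝ, HasSum (fun n : ℕ => x ^ n / n.factorial) (Real.exp x) := by
    intro x
    rw [Real.exp_eq_exp_ℝ]
    exact NormedSpace.expSeries_div_hasSum_exp x
  have hsum : HasSum (fun n : ℕ => ∫ w, F w *
        ((c * coordZ w + d * coordZbar w) ^ n / n.factorial * gaussFun κ ψ 0 0 w))
      (∫ w, F w * (Complex.exp (c * coordZ w + d * coordZbar w) * gaussFun κ ψ 0 0 w)) := by
    refine hasSum_integral_of_dominated_convergence
      (fun n w => (‖F w‖ * ‖gaussFun κ ψ 0 0 w‖) * ((s * ‖coordZ w‖) ^ n / n.factorial))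
      (fun n => ?_) (fun n => .of_forall fun w => ?_) (.of_forall fun w => ?_) ?_
      (.of_forall fun w => ?_)
    · refine hF.aestronglyMeasurable.mul (Continuous.aestronglyMeasurable ?_)
      have := (contDiff_gaussFun hψ κ 0 0).continuous
      fun_prop
    · rw [norm_mul, norm_mul, norm_div, norm_pow, Complex.norm_natCast]
      have h1 : ‖c * coordZ w + d * coordZbar w‖ ≤ s * ‖coordZ w‖ := by
        refine (norm_add_le _ _).trans (le_of_eq ?_)
        rw [norm_mul, norm_mul, norm_coordZbar, hs]
        ring
      calc ‖F w‖ * (‖c * coordZ w + d * coordZbar w‖ ^ n / n.factorial * ‖gaussFun κ ψ 0 0 w‖)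
          ≤ ‖F w‖ * ((s * ‖coordZ w‖) ^ n / n.factorial * ‖gaussFun κ ψ 0 0 w‖) := by gcongr
        _ = _ := by ring
    · exact (hexp _).summable.mul_left _
    · have h1 : ∀ w, ∑' n : ℕ, (‖F w‖ * ‖gaussFun κ ψ 0 0 w‖) *
          ((s * ‖coordZ w‖) ^ n / n.factorial) =
          ‖F w‖ * (Real.exp (s * ‖coordZ w‖) * ‖gaussFun κ ψ 0 0 w‖) := by
        intro w
        rw [((hexp _).mul_left _).tsum_eq]
        ring
      simp_rw [h1]
      refine ((integrable_mul_gaussFun hF (half_pos hκ) hψ 0 0).norm.const_mul C).mono'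
        ?_ (.of_forall fun w => ?_)
      · refine hF.aestronglyMeasurable.norm.mul (Continuous.aestronglyMeasurable ?_)
        have := (contDiff_gaussFun hψ κ 0 0).continuous
        fun_prop
      · rw [Real.norm_of_nonneg (by positivity), norm_mul, mul_left_comm C]
        exact mul_le_mul_of_nonneg_left (hC w) (norm_nonneg _)
    · refine HasSum.mul_left _ (HasSum.mul_right _ ?_)
      rw [Complex.exp_eq_exp_ℂ]
      exact NormedSpace.expSeries_div_hasSum_exp _
  have hz : ∀ n : ℕ, ∫ w, F w *
      ((c * coordZ w + d * coordZbar w) ^ n / n.factorial * gaussFun κ ψ 0 0 w) = 0 := by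
    intro n
    have h1 : ∀ w, F w *
        ((c * coordZ w + d * coordZbar w) ^ n / n.factorial * gaussFun κ ψ 0 0 w) =
        (n.factorial : ℂ)⁻¹ *
          (F w * ((c * coordZ w + d * coordZbar w) ^ n * gaussFun κ ψ 0 0 w)) := by
      intro w; ring
    simp_rw [h1]
    rw [integral_const_mul, integral_linear_pow_mul_gaussFun hF hκ hψ h, mul_zero]
  simp_rw [hz] at hsum
  exact hsum.unique hasSum_zero

theorem IsBump.mul_exp (h : IsBump O ψ) (c : ℂ) :
    IsBump O (fun x => Complex.exp (c * x) * ψ x) :=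
  h.mul fun _ _ _ => (contDiffAt_const.mul (contDiffAt_ofReal contDiffAt_id)).cexp

/-- The character splits: its ζ part is the exponential of a linear form in ζ and conj ζ, and its τ
part is absorbed into the bump. -/
theorem fourier_mul_gaussFun_eq_zero (hF : MemLp F 2 volume) {κ : ℝ} (hκ : 0 < κ)
    (h : ∀ ψ, IsBump O ψ → ∀ a b, ∫ w, F w * gaussFun κ ψ a b w = 0) (hψ : IsBump O ψ)
    (y : Freq) : 𝓕 (fun w => F w * gaussFun κ ψ 0 0 w) y = 0 := by
  rw [Real.fourier_eq']
  rw [← integral_exp_mul_gaussFun hF hκ (hψ.mul_exp (-2 * π * Complex.I * freqT y))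
    (h _ (hψ.mul_exp _)) (-π * Complex.I * coordZbar y) (-π * Complex.I * coordZ y)]
  congr 1
  ext w
  rw [gaussFun_mul, smul_eq_mul]
  have h1 : ((inner ℝ w y : ℝ) : ℂ) =
      (coordZbar y * coordZ w + coordZ y * coordZbar w) / 2 + freqT y * freqT w := by
    obtain ⟨h2, h3⟩ := coordZ_freqRe_freqIm w
    obtain ⟨h4, h5⟩ := coordZ_freqRe_freqIm y
    have h6 : inner ℝ w y = freqRe w * freqRe y + freqIm w * freqIm y + freqT w * freqT y := by
      simp [WithLp.prod_inner_apply, Complex.inner, freqRe, freqIm, freqT]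
      ring
    rw [h2, h3, h4, h5, h6]
    push_cast
    linear_combination ((freqIm w : ℂ) * freqIm y) * Complex.I_sq
  have h7 : (((-2 * π * inner ℝ w y : ℝ) : ℂ) * Complex.I) =
      (-π * Complex.I * coordZbar y * coordZ w + -π * Complex.I * coordZ y * coordZbar w) +
        -2 * π * Complex.I * freqT y * freqT w := by
    push_cast
    rw [h1]
    ring
  rw [h7, Complex.exp_add]
  ring

/-- Near each admissible τ some bump is nonzero and the Gaussian never vanishes, so F = 0 almost
everywhere locally. The remaining τ are countable, hence their preimage is null. -/
theorem ae_eq_zero_of_integral_mul_gaussFun (hF : MemLp F 2 volume) {κ : ℝ} (hκ : 0 < κ)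
    (hO : IsOpen (O \ {0})) (hOc : (O \ {0})ᶜ.Countable)
    (h : ∀ ψ, IsBump O ψ → ∀ a b, ∫ w, F w * gaussFun κ ψ a b w = 0) :
    ∀ᵐ w, F w = 0 := by
  have h1 : volume {w : Freq | F w ≠ 0 ∧ freqT w ∈ O \ {0}} = 0 := by
    refine measure_null_of_locally_null _ fun w hw => ?_
    obtain ⟨ψ, hψ, hψ1⟩ := exists_isBump_of_isOpen hO (fun h => h.2 rfl) hw.2
    have hψ := hψ.mono Set.sdiff_subset
    have h2 := ae_eq_zero_of_fourier_eq_zero (integrable_mul_gaussFun hF hκ hψ 0 0)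
      (fourier_mul_gaussFun_eq_zero hF hκ h hψ)
    refine ⟨{w | F w ≠ 0 ∧ ψ (freqT w) ≠ 0}, ?_, measure_mono_null (fun x hx => ?_)
      (ae_iff.1 h2)⟩
    · have h3 : ∀ᶠ x in nhds w, ψ (freqT x) ≠ 0 := by
        refine (hψ.contDiff.continuous.comp freqT.continuous).continuousAt.eventually_ne ?_
        simp [hψ1]
      filter_upwards [self_mem_nhdsWithin, nhdsWithin_le_nhds h3] with x hx1 hx2
      exact ⟨hx1.1, hx2⟩
    · simp only [Set.mem_ofPred_eq, gaussFun, pow_zero, mul_one]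
      exact mul_ne_zero hx.1 (mul_ne_zero hx.2 (Complex.exp_ne_zero _))
  have h2 : volume (freqT ⁻¹' (O \ {0})ᶜ) = 0 := by
    have hq : Measure.QuasiMeasurePreserving (fun w : Freq => freqT w) volume volume :=
      (Measure.quasiMeasurePreserving_snd (μ := (volume : Measure ℂ))
        (ν := (volume : Measure ℝ))).comp
        (WithLp.volume_preserving_ofLp ℂ ℝ).quasiMeasurePreserving
    exact hq.preimage_null (hOc.measure_zero volume)
  refine measure_mono_null (fun w hw => ?_) (measure_union_null h1 h2)
  by_cases hw' : freqT w ∈ O \ {0}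
  · exact Or.inl ⟨hw, hw'⟩
  · exact Or.inr hw'

/-- The Gaussian monomials with bumps supported in `O` span a dense subspace of `L²`. -/
theorem dense_span_gaussSchwartz (hO : IsOpen (O \ {0})) (hOc : (O \ {0})ᶜ.Countable)
    {κ : ℝ} (hκ : 0 < κ) :
    Dense (Submodule.span ℂ {f : Lp ℂ 2 (volume : Measure Freq) |
      ∃ ψ, ∃ hψ : IsBump O ψ, ∃ a b, f = (gaussSchwartz hκ hψ a b).toLp 2 volume} :
        Set (Lp ℂ 2 (volume : Measure Freq))) := by
  rw [Submodule.dense_iff_topologicalClosure_eq_top, Submodule.topologicalClosure_eq_top_iff,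
    Submodule.eq_bot_iff]
  intro f hf
  -- Conjugating f turns orthogonality into vanishing of the bilinear pairing.
  have hF : MemLp (fun w => (starRingEnd ℂ) (f w)) 2 volume := (Lp.memLp f).star
  have h0 : ∀ ψ, IsBump O ψ → ∀ a b,
      ∫ w, (starRingEnd ℂ) (f w) * gaussFun κ ψ a b w = 0 := by
    intro ψ hψ a b
    have h1 := Submodule.inner_left_of_mem_orthogonal
      (Submodule.subset_span ⟨ψ, hψ, a, b, rfl⟩ :
        (gaussSchwartz hκ hψ a b).toLp 2 volume ∈ Submodule.span ℂ
          {f : Lp ℂ 2 (volume : Measure Freq) |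
            ∃ ψ, ∃ hψ : IsBump O ψ, ∃ a b, f = (gaussSchwartz hκ hψ a b).toLp 2 volume}) hf
    rw [← h1, L2.inner_def]
    refine integral_congr_ae ?_
    filter_upwards [(gaussSchwartz hκ hψ a b).coeFn_toLp 2 volume] with w hw
    rw [hw, RCLike.inner_apply, gaussSchwartz_apply, mul_comm]
  have h2 := ae_eq_zero_of_integral_mul_gaussFun hF hκ hO hOc h0
  refine (Lp.eq_zero_iff_ae_eq_zero).2 ?_
  filter_upwards [h2] with w hw
  simpa using hw

end Totality

/-! ### Dense range and approximate eigenvectors of the sub-Laplacian. -/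

section Spectrum

theorem shift_subLaplacian_synthesis (lam : ℂ) (v : 𝓢(Freq, ℂ)) :
    shift subLaplacian lam ⟨schwartzToL2 (synthesis v), LinearMap.mem_range_self _ _⟩ =
      schwartzToL2 (synthesis (freqSubLaplacian v - lam • v)) := by
  rw [shift_apply, subLaplacian_apply, subLaplacianSchwartz_synthesis, synthesis_sub,
    synthesis_smul, map_sub, map_smul]

/-- Monomials with bumps in `regularFreq lam` synthesise to exact elements of the range. They are
total in frequency, synthesis is isometric, and Schwartz functions are dense in L². -/
theorem denseRange_shift_subLaplacian (lam : ℂ) : DenseRange (shift subLaplacian lam) := by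
  have hmem : ∀ f ∈ Submodule.span ℂ {f : Lp ℂ 2 (volume : Measure Freq) |
      ∃ ψ, ∃ hψ : IsBump (regularFreq lam) ψ, ∃ a b,
        f = (gaussSchwartz half_pi_pos hψ a b).toLp 2 volume},
      ∃ v : 𝓢(Freq, ℂ), f = v.toLp 2 volume ∧
        schwartzToL2 (synthesis v) ∈ LinearMap.range (shift subLaplacian lam) := by
    intro f hf
    induction hf using Submodule.span_induction with
    | mem f hf =>
      obtain ⟨ψ, hψ, a, b, rfl⟩ := hf
      obtain ⟨v, hv⟩ := exists_freqSubLaplacian_sub_eq a b ψ hψ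
      exact ⟨_, rfl, _, by rw [shift_subLaplacian_synthesis, hv]⟩
    | zero =>
      refine ⟨0, (map_zero (SchwartzMap.toLpCLM ℂ ℂ 2 (volume : Measure Freq))).symm, ?_⟩
      rw [← zero_smul ℂ (0 : 𝓢(Freq, ℂ)), synthesis_smul, zero_smul, map_zero]
      exact Submodule.zero_mem _
    | add f g _ _ hf hg =>
      obtain ⟨u, rfl, hu⟩ := hf
      obtain ⟨v, rfl, hv⟩ := hg
      refine ⟨u + v, (map_add (SchwartzMap.toLpCLM ℂ ℂ 2 (volume : Measure Freq)) u v).symm, ?_⟩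
      rw [synthesis_add, map_add]
      exact Submodule.add_mem _ hu hv
    | smul c f _ hf =>
      obtain ⟨u, rfl, hu⟩ := hf
      refine ⟨c • u, (map_smul (SchwartzMap.toLpCLM ℂ ℂ 2 (volume : Measure Freq)) c u).symm, ?_⟩
      rw [synthesis_smul, map_smul]
      exact Submodule.smul_mem _ c hu
  refine (dense_subLaplacian_domain.mono ?_).of_closure
  rintro _ ⟨u, rfl⟩
  obtain ⟨v, rfl⟩ := synthesis_surjective u
  refine Metric.mem_closure_iff.2 fun ε hε => ?_
  obtain ⟨f, hf, hd⟩ := Metric.mem_closure_iff.1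
    (dense_span_gaussSchwartz (isOpen_regularFreq lam) (countable_compl_regularFreq lam)
      half_pi_pos (v.toLp 2 volume)) ε hε
  obtain ⟨v', rfl, hv'⟩ := hmem f hf
  refine ⟨_, hv', ?_⟩
  rw [dist_eq_norm, ← map_sub, ← synthesis_sub, norm_schwartzToL2_synthesis]
  rw [dist_eq_norm] at hd
  rwa [show (v - v').toLp 2 volume = v.toLp 2 volume - v'.toLp 2 volume from
    map_sub (SchwartzMap.toLpCLM ℂ ℂ 2 (volume : Measure Freq)) v v']

theorem exists_approx_eigenvector (r : ℝ) (hr : 0 ≤ r) (ε : ℝ) (hε : 0 < ε) :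
    ∃ x : subLaplacian.domain, x ≠ 0 ∧ ‖shift subLaplacian r x‖ ≤ ε * ‖(x : L2)‖ := by
  obtain ⟨v, hv, h⟩ := exists_approx_eigenfunction hr hε
  refine ⟨⟨schwartzToL2 (synthesis v), LinearMap.mem_range_self _ _⟩, fun h0 => hv ?_, ?_⟩
  · have h1 : schwartzToL2 (synthesis v) = 0 := congrArg Subtype.val h0
    rw [← norm_eq_zero, norm_schwartzToL2_synthesis, norm_eq_zero] at h1
    exact SchwartzMap.injective_toLp (E := Freq) (F := ℂ) 2 volume (h1.trans
      (map_zero (SchwartzMap.toLpCLM ℂ ℂ 2 (volume : Measure Freq))).symm)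
  · rw [shift_subLaplacian_synthesis, norm_schwartzToL2_synthesis, norm_schwartzToL2_synthesis]
    refine Lp.norm_le_mul_norm_of_ae_le_mul ?_
    filter_upwards [v.coeFn_toLp 2 volume,
      (freqSubLaplacian v - (r : ℂ) • v).coeFn_toLp 2 volume] with w h1 h2
    rw [h1, h2]
    exact h w

end Spectrum

end Heisenberg

end

theorem theorem4 :
    Dense (Heisenberg.subLaplacian.domain : Set Heisenberg.L2) ∧
    Heisenberg.subLaplacian.IsClosable ∧
    Heisenberg.spectrum Heisenberg.subLaplacian.closure =
      ((fun r : ℝ => (r : ℂ)) '' Set.Ici 0) ∧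
    Heisenberg.continuousSpectrum Heisenberg.subLaplacian.closure =
      ((fun r : ℝ => (r : ℂ)) '' Set.Ici 0) :=
  ⟨Heisenberg.dense_subLaplacian_domain,
    Heisenberg.isClosable_of_symmetric Heisenberg.dense_subLaplacian_domain
      Heisenberg.subLaplacian_symmetric,
    Heisenberg.spectrum_closure_eq Heisenberg.dense_subLaplacian_domain
      Heisenberg.subLaplacian_symmetric Heisenberg.subLaplacian_nonneg
      Heisenberg.denseRange_shift_subLaplacian Heisenberg.exists_approx_eigenvector⟩
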